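/- A set $S$ of vertices of a graph $G$ is a mutual-visibility set if any two vertices of $S$ are joined by a shortest path of $G$ none of whose internal vertices lies in $S$. The mutual-visibility chromatic number $\chi_\mu(G)$ is the smallest number of colors in a coloring of the vertices of $G$ such that every color class is a mutual-visibility set. The glued binary tree $GT(r)$ is obtained from two copies of the perfect binary tree of depth $r$ (every non-leaf vertex has exactly two children and every leaf has depth $r$) by identifying each leaf of the first copy with the corresponding leaf of the second. **Theorem.** Let $r \ge 2$ be an integer. There is a unique integer $i$ such that $2^{i-1}+i-2 \le r \le 2^i+i-2$, and for this $i$ $$\chi_\mu(GT(r))=\begin{cases} 2(r-i)+3 & \text{if } 2^{i-1}+i-2 \le r \le 2^{i-1}+2^{i-2}+i-3,\\ 2(r-i)+2 & \text{if } 2^{i-1}+2^{i-2}+i-2 \le r \le 2^i+i-2.\end{cases}$$ -/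

import Mathlib

/-- `S` is a mutual-visibility set of `G`: any two vertices of `S` are joined by a shortest path
none of whose internal vertices lies in `S`. (A walk whose length is the distance of its ends is
automatically a shortest path.) -/
def IsMutualVisibilitySet {V : Type*} (G : SimpleGraph V) (S : Set V) : Prop :=
  ∀ x ∈ S, ∀ y ∈ S, ∃ p : G.Walk x y, p.length = G.dist x y ∧
    ∀ z ∈ p.support, z ≠ x → z ≠ y → z ∉ S

/-- A vertex coloring all of whose color classes are mutual-visibility sets. -/
def IsMutualVisibilityColoring {V C : Type*} (G : SimpleGraph V) (c : V → C) : Prop :=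
  ∀ a : C, IsMutualVisibilitySet G {v | c v = a}

/-- The mutual-visibility chromatic number of a graph: the smallest `k` for which a
mutual-visibility coloring with `k` colors exists. On finite graphs such a `k` always exists, as one
can color all vertices differently. -/
noncomputable def mutualVisibilityChromaticNumber {V : Type*} (G : SimpleGraph V) : ℕ :=
  sInf {k : ℕ | ∃ c : V → Fin k, IsMutualVisibilityColoring G c}

/-- The vertices of the glued binary tree `GT(r)`. A vertex of the perfect binary tree of depth `r`
is a word of length at most `r` in two letters: its length is the depth, the root is the empty word,
and the children of `w` are the words `a :: w`. The non-leaf vertices (words of length less than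
`r`) occur in two copies; the leaves (words of length `r`) of the two copies are identified and
occur once. -/
inductive GluedBinaryTreeVertex (r : ℕ) : Type
  | inner (copy : Bool) (w : List (Fin 2)) (hw : w.length < r) : GluedBinaryTreeVertex r
  | quasiLeaf (w : List (Fin 2)) (hw : w.length = r) : GluedBinaryTreeVertex r

/-- `y` is a child of `x` in one of the two copies of the perfect binary tree. -/
def GluedBinaryTreeVertex.IsChild {r : ℕ} : (x y : GluedBinaryTreeVertex r) → Prop
  | .inner b u _, .inner b' v _ => b = b' ∧ ∃ a : Fin 2, v = a :: u
  | .inner _ u _, .quasiLeaf v _ => ∃ a : Fin 2, v = a :: u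
  | .quasiLeaf _ _, _ => False

/-- The glued binary tree `GT(r)`: two perfect binary trees of depth `r` whose corresponding
leaves are identified. -/
def gluedBinaryTree (r : ℕ) : SimpleGraph (GluedBinaryTreeVertex r) :=
  SimpleGraph.fromRel GluedBinaryTreeVertex.IsChild

-- Words are stored with the letter nearest the root last, so ancestors are suffixes. Forgetting the
-- copy maps `GT(r)` onto one tree without increasing distances. Hence a geodesic between two
-- vertices of one copy is a tree geodesic, and one between the copies crosses at a quasi-leaf below
-- its deeper end. A member of a mutual-visibility set that is not on such a geodesic cannot
-- separate its ends in the tree.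
--
-- Lower bound. These separation constraints force every mutual-visibility set to be almost an
-- antichain (`isThin_of_isMutualVisibilitySet`): an antichain after deleting one vertex, or an
-- antichain confined to a proper subtree after deleting two. Give a vertex of depth `d` the weight
-- `2 ^ (r - max d j)`. By Kraft's inequality an antichain weighs at most `2 ^ r`, and at most half
-- of that inside a proper subtree; the cutoff `j` keeps the exceptional vertices cheap. So a class
-- weighs at most `2 ^ r + 2 ^ (r - j)` (`sum_weight_le`), and comparing with the total weight
-- bounds the number of colors (`le_mul_of_coloring`). The choice `j = m = i - 1` gives the exact
-- value in both ranges.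
--
-- Upper bound. A whole level of one copy stays a mutual-visibility set when a single vertex of the
-- other copy, at most as deep, is added. Thus the few vertices near the roots are absorbed one by
-- one by the deeper levels. With `2 ^ m - 1` shallow vertices per copy this works once there are
-- that many levels (`exists_levelColoring`). When there are about half as many levels again, level
-- `m` can also be dissolved: half of it in each copy goes into one mixed class, which saves a color
-- (`exists_mixedColoring`).

namespace GluedBinaryTree

-- Common suffixes and distances in the infinite tree of words.

section Words

variable {α : Type*}

open Classical in
/-- The length of the longest common suffix of two words. -/
noncomputable def meet (u v : List α) : ℕ :=
  Nat.findGreatest (fun k => ∃ s : List α, s.length = k ∧ s <:+ u ∧ s <:+ v) u.length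

theorem length_le_meet {s u v : List α} (hu : s <:+ u) (hv : s <:+ v) : s.length ≤ meet u v := by
  classical
  exact Nat.le_findGreatest hu.length_le ⟨s, rfl, hu, hv⟩

theorem exists_length_eq_meet (u v : List α) : ∃ s, s.length = meet u v ∧ s <:+ u ∧ s <:+ v := by
  classical
  exact Nat.findGreatest_spec (P := fun k => ∃ s : List α, s.length = k ∧ s <:+ u ∧ s <:+ v)
    (Nat.zero_le u.length) ⟨[], rfl, List.nil_suffix, List.nil_suffix⟩

theorem meet_le_left (u v : List α) : meet u v ≤ u.length := by
  obtain ⟨s, hs, hu, -⟩ := exists_length_eq_meet u v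
  exact hs ▸ hu.length_le

theorem meet_le_right (u v : List α) : meet u v ≤ v.length := by
  obtain ⟨s, hs, -, hv⟩ := exists_length_eq_meet u v
  exact hs ▸ hv.length_le

theorem meet_comm (u v : List α) : meet u v = meet v u := by
  obtain ⟨s, hs, hu, hv⟩ := exists_length_eq_meet u v
  obtain ⟨t, ht, hv', hu'⟩ := exists_length_eq_meet v u
  have h₁ := length_le_meet hv hu
  have h₂ := length_le_meet hu' hv'
  omega

/-- The ultrametric inequality for the depth of the lowest common ancestor: two suffixes of the same
`v` are nested. With it, all later distance comparisons become linear arithmetic. -/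
theorem min_meet_le (u v w : List α) : min (meet u v) (meet v w) ≤ meet u w := by
  obtain ⟨s, hs, hu, hv⟩ := exists_length_eq_meet u v
  obtain ⟨t, ht, hv', hw⟩ := exists_length_eq_meet v w
  rcases le_total s.length t.length with h | h
  · have := length_le_meet hu ((List.suffix_of_suffix_length_le hv hv' h).trans hw)
    omega
  · have := length_le_meet ((List.suffix_of_suffix_length_le hv' hv h).trans hu) hw
    omega

theorem suffix_of_length_le_meet {u v : List α} (h : u.length ≤ meet u v) : u <:+ v := by
  obtain ⟨s, hs, hu, hv⟩ := exists_length_eq_meet u v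
  have : s = u := hu.eq_of_length_le (by omega)
  exact this ▸ hv

theorem meet_eq_length {u v : List α} (h : u <:+ v) : meet u v = u.length :=
  le_antisymm (meet_le_left u v) (length_le_meet List.suffix_rfl h)

theorem meet_le_meet_cons (a : α) (u v : List α) : meet u v ≤ meet (a :: u) v := by
  obtain ⟨s, hs, hu, hv⟩ := exists_length_eq_meet u v
  exact hs ▸ length_le_meet (hu.trans (List.suffix_cons a u)) hv

theorem meet_cons_le (a : α) (u v : List α) : meet (a :: u) v ≤ meet u v + 1 := by
  obtain ⟨s, hs, hu, hv⟩ := exists_length_eq_meet (a :: u) v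
  rcases List.suffix_cons_iff.1 hu with rfl | h
  · have := length_le_meet List.suffix_rfl ((List.suffix_cons a u).trans hv)
    simp only [List.length_cons] at hs
    omega
  · have := length_le_meet h hv
    omega

/-- The distance of two words in the infinite tree of all words. -/
noncomputable def wordDist (u v : List α) : ℕ := u.length + v.length - 2 * meet u v

theorem wordDist_cons_le (a : α) (u v : List α) : wordDist (a :: u) v ≤ wordDist u v + 1 := by
  have h₁ := meet_le_meet_cons a u v
  have h₂ := meet_le_left u v
  have h₃ := meet_le_right u v
  simp only [wordDist, List.length_cons]
  omega

theorem wordDist_le_cons (a : α) (u v : List α) : wordDist u v ≤ wordDist (a :: u) v + 1 := by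
  have h₁ := meet_cons_le a u v
  have h₂ := meet_le_left (a :: u) v
  have h₃ := meet_le_right (a :: u) v
  simp only [wordDist, List.length_cons] at *
  omega

/-- `s` and `s'` lie in the same branch at `t`: below the same child of `t`, or both not strictly
below `t`. -/
def SameSide (t s s' : List α) : Prop := ∀ a, a :: t <:+ s ↔ a :: t <:+ s'

theorem SameSide.symm {t s s' : List α} (h : SameSide t s s') : SameSide t s' s :=
  fun a => (h a).symm

theorem SameSide.trans {t s s' s'' : List α} (h : SameSide t s s') (h' : SameSide t s' s'') :
    SameSide t s s'' := fun a => (h a).trans (h' a)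

theorem sameSide_refl (t s : List α) : SameSide t s s := fun _ => Iff.rfl

theorem sameSide_cons {t s : List α} (a : α) (h : s ≠ t) : SameSide t s (a :: s) := by
  intro b
  rw [List.suffix_cons_iff (l₂ := s)]
  constructor
  · exact Or.inr
  · rintro (h' | h')
    · exact absurd (List.cons.inj h').2.symm h
    · exact h'

theorem exists_cons_suffix {t s : List α} (h : t <:+ s) (hne : t ≠ s) : ∃ a, a :: t <:+ s := by
  obtain ⟨l, rfl⟩ := h
  rcases List.eq_nil_or_concat l with rfl | ⟨l', a, rfl⟩
  · simp at hne
  · exact ⟨a, l', by simp⟩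

theorem suffix_of_cons_suffix {a : α} {t s : List α} (h : a :: t <:+ s) : t <:+ s :=
  (List.suffix_cons a t).trans h

end Words

-- Walks, distances and geodesics in the glued binary tree.

section Graph

variable {r : ℕ}

/-- The word of a vertex. -/
def word : GluedBinaryTreeVertex r → List (Fin 2)
  | .inner _ w _ => w
  | .quasiLeaf w _ => w

/-- The copy of the tree in which an inner vertex lies; `none` for the quasi-leaves. -/
def side : GluedBinaryTreeVertex r → Option Bool
  | .inner b _ _ => some b
  | .quasiLeaf _ _ => none

theorem word_length_le (x : GluedBinaryTreeVertex r) : (word x).length ≤ r := by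
  cases x with
  | inner b w h => exact h.le
  | quasiLeaf w h => exact h.le

theorem word_length_lt {x : GluedBinaryTreeVertex r} {b : Bool} (h : side x = some b) :
    (word x).length < r := by
  cases x with
  | inner b w h' => exact h'
  | quasiLeaf w h' => cases h

theorem word_length_eq {x : GluedBinaryTreeVertex r} (h : side x = none) :
    (word x).length = r := by
  cases x with
  | inner b w h' => cases h
  | quasiLeaf w h' => exact h'

theorem eq_of_side_word {x y : GluedBinaryTreeVertex r} (hs : side x = side y)
    (hw : word x = word y) : x = y := by
  cases x <;> cases y <;> simp_all [side, word]

theorem adj_word {x y : GluedBinaryTreeVertex r} (h : (gluedBinaryTree r).Adj x y) :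
    (∃ a, word y = a :: word x) ∨ ∃ a, word x = a :: word y := by
  rw [gluedBinaryTree, SimpleGraph.fromRel_adj] at h
  cases x <;> cases y <;>
    simp only [GluedBinaryTreeVertex.IsChild, word] at h ⊢ <;> tauto

theorem adj_side {x y : GluedBinaryTreeVertex r} (h : (gluedBinaryTree r).Adj x y) :
    (side x = side y ∧ side x ≠ none) ∨ (side x = none ∧ side y ≠ none) ∨
      (side x ≠ none ∧ side y = none) := by
  rw [gluedBinaryTree, SimpleGraph.fromRel_adj] at h
  cases x <;> cases y <;>
    simp_all [GluedBinaryTreeVertex.IsChild, side]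
  tauto

/-- The vertex of the copy `b` with the word `t`. -/
def node (b : Bool) (t : List (Fin 2)) (h : t.length ≤ r) : GluedBinaryTreeVertex r :=
  if h' : t.length < r then .inner b t h' else .quasiLeaf t (le_antisymm h (not_lt.1 h'))

@[simp] theorem word_node (b : Bool) (t : List (Fin 2)) (h : t.length ≤ r) :
    word (node b t h) = t := by
  unfold node; split <;> rfl

theorem side_node (b : Bool) (t : List (Fin 2)) (h : t.length ≤ r) :
    side (node b t h) = some b ∨ side (node b t h) = none := by
  unfold node; split <;> simp [side]

theorem side_node_of_lt (b : Bool) {t : List (Fin 2)} (h : t.length < r) :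
    side (node b t h.le) = some b := by
  unfold node; rw [dif_pos h]; rfl

theorem side_node_of_eq (b : Bool) {t : List (Fin 2)} (h : t.length = r) :
    side (node b t h.le) = none := by
  unfold node; rw [dif_neg (by omega)]; rfl

theorem eq_node {x : GluedBinaryTreeVertex r} {b : Bool} (h : side x = some b ∨ side x = none) :
    x = node b (word x) (word_length_le x) := by
  apply eq_of_side_word _ (by simp)
  rcases h with h | h
  · rw [h, side_node_of_lt b (word_length_lt h)]
  · rw [h, side_node_of_eq b (word_length_eq h)]

theorem node_leaf (b b' : Bool) {t : List (Fin 2)} (h : t.length = r) :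
    node b t h.le = (node b' t h.le : GluedBinaryTreeVertex r) :=
  eq_of_side_word (by rw [side_node_of_eq _ h, side_node_of_eq _ h]) (by simp)

theorem node_adj (b : Bool) (a : Fin 2) (t : List (Fin 2)) (h : (a :: t).length ≤ r) :
    (gluedBinaryTree r).Adj (node b (a :: t) h) (node b t ((Nat.le_succ _).trans h)) := by
  rw [gluedBinaryTree, SimpleGraph.fromRel_adj]
  refine ⟨fun h' => ?_, Or.inr ?_⟩
  · have := congrArg word h'
    simp at this
  · have ht : t.length < r := h
    unfold node
    rw [dif_pos ht]
    split <;> simp [GluedBinaryTreeVertex.IsChild]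

/-- The projection to words sends edges to edges of the tree, so it does not lengthen walks. -/
theorem wordDist_le_length {x y : GluedBinaryTreeVertex r} (p : (gluedBinaryTree r).Walk x y) :
    wordDist (word x) (word y) ≤ p.length := by
  induction p with
  | nil => simp [wordDist, meet_eq_length List.suffix_rfl]; omega
  | cons h p ih =>
    rw [SimpleGraph.Walk.length_cons]
    rcases adj_word h with ⟨a, ha⟩ | ⟨a, ha⟩
    · rw [ha] at ih
      exact (wordDist_le_cons a _ _).trans (by omega)
    · rw [ha]
      exact (wordDist_cons_le a _ _).trans (by omega)

theorem exists_climb (b : Bool) {t u : List (Fin 2)} (h : t <:+ u) (hu : u.length ≤ r) :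
    ∃ p : (gluedBinaryTree r).Walk (node b u hu) (node b t (h.length_le.trans hu)),
      p.length = u.length - t.length ∧
      ∀ z ∈ p.support, ∃ s hs, z = node b s hs ∧ t <:+ s ∧ s <:+ u := by
  induction u with
  | nil =>
    obtain rfl := List.suffix_nil.1 h
    exact ⟨.nil, by simp, by simp [node]⟩
  | cons a u ih =>
    by_cases htu : t = a :: u
    · subst htu
      exact ⟨.nil, by simp, fun z hz => ⟨_, hu, by simpa using hz, List.suffix_rfl,
        List.suffix_rfl⟩⟩
    · have h' : t <:+ u := (List.suffix_cons_iff.1 h).resolve_left htu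
      obtain ⟨p, hp, hs⟩ := ih h' ((Nat.le_succ _).trans hu)
      refine ⟨.cons (node_adj b a u hu) p, ?_, ?_⟩
      · have := h'.length_le
        simp only [SimpleGraph.Walk.length_cons, List.length_cons]
        omega
      · intro z hz
        rw [SimpleGraph.Walk.support_cons, List.mem_cons] at hz
        rcases hz with rfl | hz
        · exact ⟨_, hu, rfl, h, List.suffix_rfl⟩
        · obtain ⟨s, h₁, h₂, h₃, h₄⟩ := hs z hz
          exact ⟨s, h₁, h₂, h₃, h₄.trans (List.suffix_cons a u)⟩

theorem exists_tree_walk (b : Bool) {u w : List (Fin 2)} (hu : u.length ≤ r) (hw : w.length ≤ r) :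
    ∃ p : (gluedBinaryTree r).Walk (node b u hu) (node b w hw),
      p.length = wordDist u w ∧
      ∀ z ∈ p.support, ∃ s hs, z = node b s hs ∧ (s <:+ u ∨ s <:+ w) ∧ meet u w ≤ s.length := by
  obtain ⟨t, ht, htu, htw⟩ := exists_length_eq_meet u w
  obtain ⟨p, hp, hps⟩ := exists_climb b htu hu
  obtain ⟨q, hq, hqs⟩ := exists_climb b htw hw
  refine ⟨p.append q.reverse, ?_, ?_⟩
  · have := htu.length_le
    have := htw.length_le
    rw [SimpleGraph.Walk.length_append, SimpleGraph.Walk.length_reverse, hp, hq, wordDist]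
    omega
  · intro z hz
    rw [SimpleGraph.Walk.mem_support_append_iff, SimpleGraph.Walk.support_reverse,
      List.mem_reverse] at hz
    rcases hz with hz | hz
    · obtain ⟨s, h₁, h₂, h₃, h₄⟩ := hps z hz
      exact ⟨s, h₁, h₂, Or.inl h₄, ht ▸ h₃.length_le⟩
    · obtain ⟨s, h₁, h₂, h₃, h₄⟩ := hqs z hz
      exact ⟨s, h₁, h₂, Or.inr h₄, ht ▸ h₃.length_le⟩

theorem exists_mem_support_side_eq_none {x y : GluedBinaryTreeVertex r}
    (p : (gluedBinaryTree r).Walk x y) (hne : side x ≠ side y) :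
    ∃ z ∈ p.support, side z = none := by
  induction p with
  | nil => exact absurd rfl hne
  | @cons x x' y h p ih =>
    by_cases hx : side x = none
    · exact ⟨x, by simp, hx⟩
    by_cases hx' : side x' = none
    · exact ⟨x', by simp, hx'⟩
    have : side x = side x' := by
      rcases adj_side h with h | h | h
      · exact h.1
      · exact absurd h.1 hx
      · exact absurd h.2 hx'
    obtain ⟨z, hz, hz'⟩ := ih (this ▸ hne)
    exact ⟨z, by simp [hz], hz'⟩

/-- Deleting `t` disconnects the tree into its branches at `t`, and a walk whose projection avoids
`t` cannot change branch. -/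
theorem sameSide_of_forall_ne {x y : GluedBinaryTreeVertex r} {t : List (Fin 2)}
    (p : (gluedBinaryTree r).Walk x y) (h : ∀ z ∈ p.support, word z ≠ t) :
    SameSide t (word x) (word y) := by
  induction p with
  | nil => exact sameSide_refl _ _
  | @cons x x' y hadj p ih =>
    refine SameSide.trans ?_ (ih fun z hz => h z (by simp [hz]))
    rcases adj_word hadj with ⟨a, ha⟩ | ⟨a, ha⟩
    · exact ha ▸ sameSide_cons a (h x (by simp))
    · exact ha ▸ (sameSide_cons a (h x' (by simp))).symm

/-- A geodesic that starts in one copy and ends in the same copy or in a quasi-leaf does not visit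
the other copy. -/
theorem side_ne_of_mem_support {x y z : GluedBinaryTreeVertex r} {b : Bool}
    (p : (gluedBinaryTree r).Walk x y) (hp : p.length ≤ wordDist (word x) (word y))
    (hx : side x = some b) (hz : z ∈ p.support) : side z ≠ some (!b) := by
  classical
  intro hzb
  -- To reach the other copy the walk passes a quasi-leaf `l`. A word of the maximal length `r` can
  -- only be an end of a tree geodesic, so `l` has the word of `y`; then so does `z` between them,
  -- although an inner vertex has a shorter word.
  obtain ⟨l, hl, hl'⟩ := exists_mem_support_side_eq_none (p.takeUntil z hz)
    (by rw [hx, hzb]; cases b <;> simp)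
  have e₁ := congrArg SimpleGraph.Walk.length (p.take_spec hz)
  have e₂ := congrArg SimpleGraph.Walk.length ((p.takeUntil z hz).take_spec hl)
  rw [SimpleGraph.Walk.length_append] at e₁ e₂
  have d₁ := wordDist_le_length ((p.takeUntil z hz).takeUntil l hl)
  have d₂ := wordDist_le_length ((p.takeUntil z hz).dropUntil l hl)
  have d₃ := wordDist_le_length (p.dropUntil z hz)
  have m₁ := min_meet_le (word x) (word l) (word y)
  have m₂ := min_meet_le (word l) (word z) (word y)
  have h₁ := word_length_lt hx
  have h₂ := word_length_eq hl'
  have h₃ := word_length_lt hzb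
  have h₄ := word_length_le y
  have k₁ := meet_le_left (word x) (word l)
  have k₂ := meet_le_left (word l) (word z)
  have k₃ := meet_le_right (word l) (word z)
  have k₄ := meet_le_left (word z) (word y)
  have k₅ := meet_le_right (word z) (word y)
  have k₆ := meet_le_left (word x) (word y)
  have k₇ := meet_le_right (word x) (word y)
  have k₈ := meet_le_right (word l) (word y)
  unfold wordDist at *
  omega

theorem sameSide_of_not_mem_support {x y z : GluedBinaryTreeVertex r} {b : Bool}
    (p : (gluedBinaryTree r).Walk x y) (hp : p.length ≤ wordDist (word x) (word y))
    (hx : side x = some b) (hz : side z = some b) (hzp : z ∉ p.support) :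
    SameSide (word z) (word x) (word y) := by
  apply sameSide_of_forall_ne p
  intro t ht heq
  have h₁ := side_ne_of_mem_support p hp hx ht
  have h₂ : side t ≠ none := fun h => by
    have := word_length_eq h
    have := word_length_lt hz
    rw [heq] at *
    omega
  have h₃ : side t = some b := by
    cases hs : side t with
    | none => exact absurd hs h₂
    | some c => rw [hs] at h₁; cases b <;> cases c <;> simp_all
  exact hzp (eq_of_side_word (h₃.trans hz.symm) heq ▸ ht)

theorem dist_le_wordDist {x y : GluedBinaryTreeVertex r} {b : Bool}
    (hx : side x = some b ∨ side x = none) (hy : side y = some b ∨ side y = none) :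
    (gluedBinaryTree r).dist x y ≤ wordDist (word x) (word y) := by
  obtain ⟨p, hp, -⟩ := exists_tree_walk b (word_length_le x) (word_length_le y)
  have := SimpleGraph.dist_le p
  rwa [hp, ← eq_node hx, ← eq_node hy] at this

theorem exists_leaf_below {t : List (Fin 2)} (h : t.length ≤ r) :
    ∃ l : List (Fin 2), l.length = r ∧ t <:+ l :=
  ⟨List.replicate (r - t.length) 0 ++ t, by simp; omega, List.suffix_append _ _⟩

/-- The walk from a vertex to a not shorter word in its own copy, on to a quasi-leaf below that
word, and back up to the word in the other copy. -/
theorem exists_cross_walk (b : Bool) {u v l : List (Fin 2)} (hu : u.length ≤ r)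
    (hl : l.length = r) (hv : v <:+ l) :
    ∃ p : (gluedBinaryTree r).Walk (node b u hu) (node (!b) v (hv.length_le.trans hl.le)),
      p.length = wordDist u l + (r - v.length) ∧
      ∀ z ∈ p.support, ∃ s hs, (z = node b s hs ∧ (s <:+ u ∨ s <:+ l) ∧ meet u l ≤ s.length) ∨
        (z = node (!b) s hs ∧ v <:+ s ∧ s <:+ l) := by
  obtain ⟨p, hp, hps⟩ := exists_tree_walk b hu hl.le
  obtain ⟨q, hq, hqs⟩ := exists_climb (!b) hv hl.le
  refine ⟨p.append (q.copy (node_leaf (!b) b hl) rfl), ?_, ?_⟩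
  · rw [SimpleGraph.Walk.length_append, SimpleGraph.Walk.length_copy, hp, hq, hl]
  · intro z hz
    rw [SimpleGraph.Walk.mem_support_append_iff, SimpleGraph.Walk.support_copy] at hz
    rcases hz with hz | hz
    · obtain ⟨s, h₁, h₂⟩ := hps z hz
      exact ⟨s, h₁, Or.inl h₂⟩
    · obtain ⟨s, h₁, h₂⟩ := hqs z hz
      exact ⟨s, h₁, Or.inr h₂⟩

theorem wordDist_leaf_le {u v l : List (Fin 2)} (hl : l.length = r) (hv : v <:+ l) :
    wordDist u l ≤ wordDist u v + (r - v.length) := by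
  have h₁ := min_meet_le u l v
  have h₂ := min_meet_le u v l
  have h₃ := meet_eq_length hv
  have h₄ := meet_comm v l
  have h₅ := hv.length_le
  have h₆ := meet_le_right u v
  have h₇ := meet_le_left u v
  have h₈ := meet_le_left u l
  unfold wordDist
  omega

theorem dist_cross_le {x y : GluedBinaryTreeVertex r} {b : Bool} (hx : side x = some b)
    (hy : side y = some (!b)) :
    (gluedBinaryTree r).dist x y ≤ wordDist (word x) (word y) + 2 * (r - (word y).length) := by
  obtain ⟨l, hl, hv⟩ := exists_leaf_below (word_length_le y)
  obtain ⟨p, hp, -⟩ := exists_cross_walk b (word_length_le x) hl hv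
  have := SimpleGraph.dist_le p
  rw [hp, ← eq_node (Or.inl hx), ← eq_node (Or.inl hy)] at this
  have := wordDist_leaf_le (u := word x) hl hv
  omega

theorem wordDist_comm {α : Type*} (u v : List α) : wordDist u v = wordDist v u := by
  rw [wordDist, wordDist, meet_comm, add_comm]

/-- The walk must visit a quasi-leaf, whose word has at most the longer of the two words in common
with either end. -/
theorem le_length_cross {x y : GluedBinaryTreeVertex r} {b : Bool} (hx : side x = some b)
    (hy : side y = some (!b)) (p : (gluedBinaryTree r).Walk x y) :
    wordDist (word x) (word y) + 2 * (r - max (word x).length (word y).length) ≤ p.length := by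
  classical
  obtain ⟨l, hl, hl'⟩ := exists_mem_support_side_eq_none p (by rw [hx, hy]; cases b <;> simp)
  have e₁ := congrArg SimpleGraph.Walk.length (p.take_spec hl)
  rw [SimpleGraph.Walk.length_append] at e₁
  have d₁ := wordDist_le_length (p.takeUntil l hl)
  have d₂ := wordDist_le_length (p.dropUntil l hl)
  have m₁ := min_meet_le (word x) (word l) (word y)
  have h₁ := word_length_lt hx
  have h₂ := word_length_eq hl'
  have h₃ := word_length_lt hy
  have k₁ := meet_le_left (word x) (word l)
  have k₂ := meet_le_right (word l) (word y)
  have k₃ := meet_le_left (word x) (word y)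
  have k₄ := meet_le_right (word x) (word y)
  unfold wordDist at *
  omega

-- Separation constraints on a mutual-visibility set.

variable {S : Set (GluedBinaryTreeVertex r)}

theorem sameSide_of_same_copy (hS : IsMutualVisibilitySet (gluedBinaryTree r) S)
    {x y z : GluedBinaryTreeVertex r} {b : Bool} (hxS : x ∈ S) (hyS : y ∈ S) (hzS : z ∈ S)
    (hx : side x = some b) (hy : side y = some b ∨ side y = none) (hz : side z = some b)
    (hzx : z ≠ x) (hzy : z ≠ y) : SameSide (word z) (word x) (word y) := by
  obtain ⟨p, hp, hps⟩ := hS x hxS y hyS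
  exact sameSide_of_not_mem_support p (hp ▸ dist_le_wordDist (Or.inl hx) hy) hx hz
    fun h => hps z h hzx hzy hzS

/-- A visible geodesic between the copies is cut at a quasi-leaf it visits. Its length meets the
upper bounds `dist_cross_le` from both ends, which forces each piece to be a tree geodesic and the
quasi-leaf to lie below a longest end. Other members of either copy then cannot separate the ends of
the piece in that copy. -/
theorem exists_leaf_of_cross (hS : IsMutualVisibilitySet (gluedBinaryTree r) S)
    {x y : GluedBinaryTreeVertex r} {b : Bool} (hxS : x ∈ S) (hyS : y ∈ S)
    (hx : side x = some b) (hy : side y = some (!b)) :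
    ∃ l : List (Fin 2), (((word x).length ≤ (word y).length ∧ word y <:+ l) ∨
        ((word y).length ≤ (word x).length ∧ word x <:+ l)) ∧ l.length = r ∧
      (∀ z ∈ S, side z = some b → z ≠ x → SameSide (word z) (word x) l) ∧
      ∀ z ∈ S, side z = some (!b) → z ≠ y → SameSide (word z) (word y) l := by
  classical
  obtain ⟨p, hp, hps⟩ := hS x hxS y hyS
  obtain ⟨l, hl, hl'⟩ := exists_mem_support_side_eq_none p (by rw [hx, hy]; cases b <;> simp)
  have e₁ := congrArg SimpleGraph.Walk.length (p.take_spec hl)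
  rw [SimpleGraph.Walk.length_append] at e₁
  have d₁ := wordDist_le_length (p.takeUntil l hl)
  have d₂ := wordDist_le_length (p.dropUntil l hl).reverse
  rw [SimpleGraph.Walk.length_reverse] at d₂
  have u₁ := dist_cross_le hx hy
  have u₂ := dist_cross_le (b := !b) hy (by simpa using hx)
  rw [SimpleGraph.dist_comm, wordDist_comm] at u₂
  have m₁ := min_meet_le (word x) (word l) (word y)
  have m₂ := min_meet_le (word x) (word y) (word l)
  have c₁ := meet_comm (word l) (word y)
  have c₂ := meet_comm (word l) (word x)
  have h₁ := word_length_lt hx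
  have h₂ := word_length_eq hl'
  have h₃ := word_length_lt hy
  have k₁ := meet_le_left (word x) (word l)
  have k₂ := meet_le_left (word y) (word l)
  have k₃ := meet_le_left (word x) (word y)
  have k₄ := meet_le_right (word x) (word y)
  have hlen : (p.takeUntil l hl).length ≤ wordDist (word x) (word l) ∧
      (p.dropUntil l hl).reverse.length ≤ wordDist (word y) (word l) ∧
      (((word x).length ≤ (word y).length ∧ (word y).length ≤ meet (word y) (word l)) ∨
        ((word y).length ≤ (word x).length ∧ (word x).length ≤ meet (word x) (word l))) := by
    rw [SimpleGraph.Walk.length_reverse]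
    unfold wordDist at *
    omega
  refine ⟨word l, ?_, h₂, fun z hzS hz hne => ?_, fun z hzS hz hne => ?_⟩
  · rcases hlen.2.2 with h | h
    · exact Or.inl ⟨h.1, suffix_of_length_le_meet h.2⟩
    · exact Or.inr ⟨h.1, suffix_of_length_le_meet h.2⟩
  · refine sameSide_of_not_mem_support _ hlen.1 hx hz fun h => ?_
    refine hps z (p.support_takeUntil_subset_support hl h) hne ?_ hzS
    rintro rfl
    rw [hz] at hy
    cases b <;> simp at hy
  · refine sameSide_of_not_mem_support _ hlen.2.1 hy hz fun h => ?_
    rw [SimpleGraph.Walk.support_reverse, List.mem_reverse] at h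
    refine hps z (p.support_dropUntil_subset_support hl h) ?_ hne hzS
    rintro rfl
    rw [hz] at hx
    cases b <;> simp at hx

/-- The first step of the geodesic leaves the quasi-leaf into some copy, and by
`side_ne_of_mem_support` the rest never enters the other one. Which copy serves may depend on the
pair. -/
theorem exists_copy_of_leaves (hS : IsMutualVisibilitySet (gluedBinaryTree r) S)
    {x y : GluedBinaryTreeVertex r} (hxS : x ∈ S) (hyS : y ∈ S)
    (hx : side x = none) (hy : side y = none) :
    ∃ b, ∀ z ∈ S, side z = some b → SameSide (word z) (word x) (word y) := by
  obtain ⟨p, hp, hps⟩ := hS x hxS y hyS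
  have hd : p.length ≤ wordDist (word x) (word y) :=
    hp ▸ dist_le_wordDist (b := true) (Or.inr hx) (Or.inr hy)
  cases p with
  | nil => exact ⟨true, fun z _ _ => sameSide_refl _ _⟩
  | @cons _ x' _ h q =>
    have hx' : side x' ≠ none := by
      rcases adj_side h with h | h | h
      · exact absurd hx h.2
      · exact h.2
      · exact absurd hx h.1
    obtain ⟨b, hb⟩ := Option.ne_none_iff_exists'.1 hx'
    obtain ⟨a, ha⟩ : ∃ a, word x = a :: word x' := by
      refine (adj_word h).resolve_left ?_
      rintro ⟨a, ha⟩
      have h₁ := word_length_le x'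
      have h₂ := word_length_eq hx
      rw [ha, List.length_cons] at h₁
      omega
    refine ⟨b, fun z hzS hz => ?_⟩
    have hzx : z ≠ x := fun h => by rw [h, hx] at hz; cases hz
    have hzy : z ≠ y := fun h => by rw [h, hy] at hz; cases hz
    have hzq : z ∉ q.support := fun h' => hps z (by simp [h']) hzx hzy hzS
    have hq : q.length ≤ wordDist (word x') (word y) := by
      have := wordDist_cons_le a (word x') (word y)
      rw [SimpleGraph.Walk.length_cons, ha] at hd
      omega
    refine SameSide.trans ?_ (sameSide_of_not_mem_support q hq hb hz hzq)
    rw [ha]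
    refine (sameSide_cons a fun h' => hzq ?_).symm
    rw [← eq_of_side_word (hb.trans hz.symm) h']
    exact q.start_mem_support

end Graph

-- Mutual-visibility sets are almost antichains.

section Structure

variable {r : ℕ} {S : Set (GluedBinaryTreeVertex r)}

/-- `x` is an inner vertex of `S` in the copy `b` above another vertex of `S` in that copy. -/
def IsTop (S : Set (GluedBinaryTreeVertex r)) (b : Bool) (x : GluedBinaryTreeVertex r) : Prop :=
  x ∈ S ∧ side x = some b ∧ ∃ y ∈ S, y ≠ x ∧ (side y = some b ∨ side y = none) ∧
    word x <:+ word y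

theorem word_ne_of_ne {x y : GluedBinaryTreeVertex r} {b : Bool} (hne : y ≠ x)
    (hx : side x = some b) (hy : side y = some b ∨ side y = none) : word x ≠ word y := by
  intro h
  rcases hy with hy | hy
  · exact hne (eq_of_side_word (hy.trans hx.symm) h.symm)
  · have h₁ := word_length_eq hy
    have h₂ := word_length_lt hx
    rw [h] at h₂
    omega

/-- The vertex `x` separates no two other members of which one is an inner vertex of its copy. The
inner vertex `z` links every member to the one already known to lie below `x`; without it, two
quasi-leaves could see each other through the other copy. -/
theorem IsTop.exists_branch (hS : IsMutualVisibilitySet (gluedBinaryTree r) S) {b : Bool}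
    {x z : GluedBinaryTreeVertex r} (hx : IsTop S b x) (hz : z ∈ S) (hzb : side z = some b)
    (hzx : z ≠ x) : ∃ a, ∀ t ∈ S, (side t = some b ∨ side t = none) → t ≠ x →
      a :: word x <:+ word t := by
  obtain ⟨hxS, hxb, y, hy, hyx, hyb, hxy⟩ := hx
  obtain ⟨a, ha⟩ := exists_cons_suffix hxy (word_ne_of_ne hyx hxb hyb)
  have hz' := (sameSide_of_same_copy hS hz hy hxS hzb hyb hxb hzx.symm hyx.symm a).2 ha
  exact ⟨a, fun t ht htb htx =>
    (sameSide_of_same_copy hS hz ht hxS hzb htb hxb hzx.symm htx.symm a).1 hz'⟩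

/-- Two tops would each lie strictly below the other. -/
theorem IsTop.unique (hS : IsMutualVisibilitySet (gluedBinaryTree r) S) {b : Bool}
    {x x' : GluedBinaryTreeVertex r} (hx : IsTop S b x) (hx' : IsTop S b x') : x = x' := by
  by_contra hne
  obtain ⟨a, ha⟩ := hx.exists_branch hS hx'.1 hx'.2.1 (Ne.symm hne)
  obtain ⟨a', ha'⟩ := hx'.exists_branch hS hx.1 hx.2.1 hne
  have h₁ := (ha x' hx'.1 (Or.inl hx'.2.1) (Ne.symm hne)).length_le
  have h₂ := (ha' x hx.1 (Or.inl hx.2.1) hne).length_le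
  simp only [List.length_cons] at h₁ h₂
  omega

/-- Here `u` lies strictly below `x`. If `v` were below `u`, the geodesic from `x` to `v` would
descend to a quasi-leaf below `v` and pass through `u`. -/
theorem IsTop.not_suffix (hS : IsMutualVisibilitySet (gluedBinaryTree r) S) {b : Bool}
    {x u v : GluedBinaryTreeVertex r} (hx : IsTop S b x) (hu : u ∈ S) (hub : side u = some b)
    (hux : u ≠ x) (hv : v ∈ S) (hvb : side v = some (!b)) : ¬ word u <:+ word v := by
  intro huv
  obtain ⟨a, ha⟩ := hx.exists_branch hS hu hub hux
  have h₁ := (ha u hu (Or.inl hub) hux).length_le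
  have h₂ := huv.length_le
  have h₃ := word_length_lt hub
  obtain ⟨l, hl, hlr, hlx, -⟩ := exists_leaf_of_cross hS hx.1 hv hx.2.1 hvb
  simp only [List.length_cons] at h₁
  obtain ⟨-, hl⟩ := hl.resolve_right fun h => by omega
  obtain ⟨a', ha'⟩ := exists_cons_suffix (huv.trans hl) (by rintro h; rw [h] at h₃; omega)
  have := ((hlx u hu hub hux a').2 ha').length_le
  simp only [List.length_cons] at this
  omega

/-- A word strictly above `l` lies strictly above every word in the same branch as `l`. -/
theorem cons_suffix_of_sameSide {z v l : List (Fin 2)} (h : SameSide z v l) (hz : z <:+ l)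
    (hne : z.length < l.length) : ∃ a, a :: z <:+ v := by
  obtain ⟨a, ha⟩ := exists_cons_suffix hz (by rintro rfl; exact lt_irrefl _ hne)
  exact ⟨a, (h a).2 ha⟩

/-- If `u₁` and `v₂` lie in different copies, then the words of `S` above the longer one of them, in
the copy of the other, lie above that other one. -/
theorem cross_mixed (hS : IsMutualVisibilitySet (gluedBinaryTree r) S) {b : Bool}
    {u₁ v₂ : GluedBinaryTreeVertex r} (hu₁ : u₁ ∈ S) (hv₂ : v₂ ∈ S)
    (hu₁b : side u₁ = some b) (hv₂b : side v₂ = some (!b)) :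
    ((word u₁).length ≤ (word v₂).length ∧ ∀ u₂ ∈ S, side u₂ = some b → u₂ ≠ u₁ →
        word u₂ <:+ word v₂ → ∃ a, a :: word u₂ <:+ word u₁) ∨
      ((word v₂).length ≤ (word u₁).length ∧ ∀ v₁ ∈ S, side v₁ = some (!b) → v₁ ≠ v₂ →
        word v₁ <:+ word u₁ → ∃ a, a :: word v₁ <:+ word v₂) := by
  obtain ⟨l, hl, hlr, h₁, h₂⟩ := exists_leaf_of_cross hS hu₁ hv₂ hu₁b hv₂b
  rcases hl with ⟨hle, hl⟩ | ⟨hle, hl⟩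
  · refine Or.inl ⟨hle, fun u₂ hu₂ hu₂b hne h => ?_⟩
    have := word_length_lt hu₂b
    exact cons_suffix_of_sameSide (h₁ u₂ hu₂ hu₂b hne) (h.trans hl) (by omega)
  · refine Or.inr ⟨hle, fun v₁ hv₁ hv₁b hne h => ?_⟩
    have := word_length_lt hv₁b
    exact cons_suffix_of_sameSide (h₂ v₁ hv₁ hv₁b hne) (h.trans hl) (by omega)

/-- Apply `cross_mixed` to the crossed pairs `u₁, v₂` and `u₂, v₁`. In each combination the strict
ancestor it produces contradicts the lengths. -/
theorem cross_unique (hS : IsMutualVisibilitySet (gluedBinaryTree r) S) {b : Bool}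
    {u₁ u₂ v₁ v₂ : GluedBinaryTreeVertex r} (hu₁ : u₁ ∈ S) (hu₂ : u₂ ∈ S) (hv₁ : v₁ ∈ S)
    (hv₂ : v₂ ∈ S) (hu₁b : side u₁ = some b) (hu₂b : side u₂ = some b)
    (hv₁b : side v₁ = some (!b)) (hv₂b : side v₂ = some (!b))
    (h₁ : word v₁ <:+ word u₁) (h₂ : word v₂ <:+ word u₂) : v₁ = v₂ := by
  by_contra hne
  have l₁ := h₁.length_le
  have l₂ := h₂.length_le
  rcases cross_mixed hS hu₁ hv₂ hu₁b hv₂b with ⟨k₁, g₁⟩ | ⟨k₁, g₁⟩ <;>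
    rcases cross_mixed hS hu₂ hv₁ hu₂b hv₁b with ⟨k₂, g₂⟩ | ⟨k₂, g₂⟩
  · have e₁ : word v₁ = word u₁ := h₁.eq_of_length (by omega)
    have e₂ : word v₂ = word u₂ := h₂.eq_of_length (by omega)
    have hu : u₂ ≠ u₁ := by
      rintro rfl
      exact hne (eq_of_side_word (hv₁b.trans hv₂b.symm) (e₁.trans e₂.symm))
    obtain ⟨a, ha⟩ := g₁ u₂ hu₂ hu₂b hu (e₂ ▸ List.suffix_rfl)
    have := ha.length_le
    simp only [List.length_cons] at this
    omega
  · obtain ⟨a, ha⟩ := g₂ v₂ hv₂ hv₂b (Ne.symm hne) h₂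
    have := ha.length_le
    simp only [List.length_cons] at this
    omega
  · obtain ⟨a, ha⟩ := g₁ v₁ hv₁ hv₁b hne h₁
    have := ha.length_le
    simp only [List.length_cons] at this
    omega
  · obtain ⟨a, ha⟩ := g₁ v₁ hv₁ hv₁b hne h₁
    obtain ⟨a', ha'⟩ := g₂ v₂ hv₂ hv₂b (Ne.symm hne) h₂
    have := ha.length_le
    have := ha'.length_le
    simp only [List.length_cons] at *
    omega

/-- The words of the vertices in `R` are pairwise incomparable. -/
def Incomparable (R : Set (GluedBinaryTreeVertex r)) : Prop :=
  R.Pairwise fun x y => ¬ word x <:+ word y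

theorem side_cases (b : Bool) (x : GluedBinaryTreeVertex r) :
    side x = some b ∨ side x = some (!b) ∨ side x = none := by
  cases hs : side x with
  | none => simp
  | some c => cases b <;> cases c <;> simp

theorem incomparable_of {R : Set (GluedBinaryTreeVertex r)} (b : Bool) (hR : R ⊆ S)
    (h : ∀ x ∈ R, ∀ c, ¬ IsTop S c x)
    (h₁ : ∀ x ∈ R, ∀ y ∈ R, side x = some b → side y = some (!b) → ¬ word x <:+ word y)
    (h₂ : ∀ x ∈ R, ∀ y ∈ R, side x = some (!b) → side y = some b → ¬ word x <:+ word y) :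
    Incomparable R := by
  intro x hx y hy hne hxy
  have htop : ∀ c, side x = some c → ¬ (side y = some c ∨ side y = none) := fun c hc hyc =>
    h x hx c ⟨hR hx, hc, y, hR hy, hne.symm, hyc, hxy⟩
  rcases side_cases b x with hs | hs | hs
  · rcases side_cases b y with hs' | hs' | hs'
    · exact htop _ hs (Or.inl hs')
    · exact h₁ x hx y hy hs hs' hxy
    · exact htop _ hs (Or.inr hs')
  · rcases side_cases b y with hs' | hs' | hs'
    · exact h₂ x hx y hy hs hs' hxy
    · exact htop _ hs (Or.inl hs')
    · exact htop _ hs (Or.inr hs')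
  · have e : word x = word y := hxy.eq_of_length_le (by
      rw [word_length_eq hs]; exact word_length_le y)
    refine hne (eq_of_side_word ?_ e)
    rw [hs]
    cases hy' : side y with
    | none => rfl
    | some c =>
      have h₁ := word_length_eq hs
      have h₂ := word_length_lt hy'
      rw [e] at h₁
      omega

/-- Without tops, only vertices of different copies are comparable. Delete some `v` above a vertex
`u` of the other copy: `cross_unique` excludes further comparabilities in this direction, and one in
the opposite direction would create a top. -/
theorem exists_incomparable_of_forall_not_isTop
    (hS : IsMutualVisibilitySet (gluedBinaryTree r) S) (h : ∀ b x, ¬ IsTop S b x) :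
    ∃ x, Incomparable (S \ {x}) := by
  by_cases hc : ∃ b, ∃ v ∈ S, ∃ u ∈ S, side v = some (!b) ∧ side u = some b ∧ word v <:+ word u
  · obtain ⟨b, v, hv, u, hu, hvb, hub, hvu⟩ := hc
    refine ⟨v, incomparable_of b Set.sdiff_subset (fun x _ c => h c x) ?_ ?_⟩
    · rintro x ⟨hx, -⟩ y ⟨hy, hyv⟩ hxb hyb hxy
      have hyv : v ≠ y := fun h => hyv h.symm
      by_cases hux : x = u
      · subst hux
        exact h (!b) v ⟨hv, hvb, y, hy, hyv.symm, Or.inl hyb, hvu.trans hxy⟩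
      · rcases cross_mixed hS hu hy hub hyb with ⟨-, g⟩ | ⟨-, g⟩
        · obtain ⟨a, ha⟩ := g x hx hxb hux hxy
          exact h b x ⟨hx, hxb, u, hu, Ne.symm hux, Or.inl hub, suffix_of_cons_suffix ha⟩
        · obtain ⟨a, ha⟩ := g v hv hvb hyv hvu
          exact h (!b) v ⟨hv, hvb, y, hy, hyv.symm, Or.inl hyb, suffix_of_cons_suffix ha⟩
    · rintro x ⟨hx, hxv⟩ y ⟨hy, -⟩ hxb hyb hxy
      exact hxv (cross_unique hS hy hu hx hv hyb hub hxb hvb hxy hvu)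
  · rcases S.eq_empty_or_nonempty with rfl | ⟨x, -⟩
    · exact ⟨node true [] (Nat.zero_le r), by simp [Incomparable]⟩
    · refine ⟨x, incomparable_of true Set.sdiff_subset (fun x _ c => h c x) ?_ ?_⟩
      · exact fun x hx y hy hxb hyb hxy => hc ⟨false, x, hx.1, y, hy.1, hxb, hyb, hxy⟩
      · exact fun x hx y hy hxb hyb hxy => hc ⟨true, x, hx.1, y, hy.1, hxb, hyb, hxy⟩

/-- All but one element are pairwise incomparable, or all but two elements are and moreover lie
below a common word different from the root. -/
def IsThin (S : Set (GluedBinaryTreeVertex r)) : Prop :=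
  (∃ x, Incomparable (S \ {x})) ∨
    ∃ x y, Incomparable (S \ {x, y}) ∧ ∃ a c, ∀ t ∈ S \ {x, y}, a :: c <:+ word t

theorem isThin_of_isTop_of_not_isTop (hS : IsMutualVisibilitySet (gluedBinaryTree r) S)
    {b : Bool} {x : GluedBinaryTreeVertex r} (hx : IsTop S b x) (h : ∀ y, ¬ IsTop S (!b) y) :
    IsThin S := by
  have htop : ∀ y, y ≠ x → ∀ c, ¬ IsTop S c y := by
    intro y hyx c hc
    rcases Bool.eq_or_eq_not c b with rfl | rfl
    · exact hyx (hc.unique hS hx)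
    · exact h y hc
  by_cases hz : ∃ z ∈ S, side z = some b ∧ z ≠ x
  · obtain ⟨z, hzS, hzb, hzx⟩ := hz
    obtain ⟨a, ha⟩ := hx.exists_branch hS hzS hzb hzx
    by_cases hc : ∃ v ∈ S, ∃ u ∈ S, u ≠ x ∧ side v = some (!b) ∧ side u = some b ∧
        word v <:+ word u
    · obtain ⟨v, hv, u, hu, hux, hvb, hub, hvu⟩ := hc
      refine Or.inr ⟨x, v, incomparable_of b Set.sdiff_subset ?_ ?_ ?_, a, word x, ?_⟩
      · rintro y ⟨-, hy⟩
        simp only [Set.mem_insert_iff, Set.mem_singleton_iff, not_or] at hy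
        exact htop y hy.1
      · rintro y ⟨hyS, hy⟩ w ⟨hwS, hw⟩ hyb hwb
        simp only [Set.mem_insert_iff, Set.mem_singleton_iff, not_or] at hy
        exact hx.not_suffix hS hyS hyb hy.1 hwS hwb
      · rintro y ⟨hyS, hy⟩ w ⟨hwS, hw⟩ hyb hwb hyw
        simp only [Set.mem_insert_iff, Set.mem_singleton_iff, not_or] at hy
        exact hy.2 (cross_unique hS hwS hu hyS hv hwb hub hyb hvb hyw hvu)
      · rintro t ⟨htS, ht⟩
        simp only [Set.mem_insert_iff, Set.mem_singleton_iff, not_or] at ht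
        rcases side_cases b t with hs | hs | hs
        · exact ha t htS (Or.inl hs) ht.1
        -- The vertex `t` lies in the other copy. If the crossing quasi-leaf is below `t`, it is
        -- also in the branch of `u` at `x`, and `t` is deep enough to be in that branch too. If it
        -- is below `u`, then `v` must lie above `t` so as not to block, and would be a top.
        · have hau := ha u hu (Or.inl hub) hux
          obtain ⟨l, hl, hlr, h₁, h₂⟩ := exists_leaf_of_cross hS hu htS hub hs
          rcases hl with ⟨hle, hl⟩ | ⟨hle, hl⟩
          · have := (h₁ x hx.1 hx.2.1 hux.symm a).1 hau
            exact List.suffix_of_suffix_length_le this hl (hau.length_le.trans hle)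
          · have := word_length_lt hvb
            obtain ⟨a', ha'⟩ := cons_suffix_of_sameSide (h₂ v hv hvb (Ne.symm ht.2))
              (hvu.trans hl) (by omega)
            exact absurd ⟨hv, hvb, t, htS, ht.2, Or.inl hs, suffix_of_cons_suffix ha'⟩ (h v)
        · exact ha t htS (Or.inr hs) ht.1
    · refine Or.inl ⟨x, incomparable_of b Set.sdiff_subset (fun y hy => htop y hy.2) ?_ ?_⟩
      · exact fun y hy w hw hyb hwb => hx.not_suffix hS hy.1 hyb hy.2 hw.1 hwb
      · exact fun y hy w hw hyb hwb hyw => hc ⟨y, hy.1, w, hw.1, hw.2, hyb, hwb, hyw⟩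
  · refine Or.inl ⟨x, incomparable_of b Set.sdiff_subset (fun y hy => htop y hy.2) ?_ ?_⟩
    · exact fun y hy w hw hyb _ _ => hz ⟨y, hy.1, hyb, hy.2⟩
    · exact fun y hy w hw _ hwb _ => hz ⟨w, hw.1, hwb, hw.2⟩

/-- All remaining members are quasi-leaves, and any two of them are in one branch at `x` or in one
branch at `x'`. If two equivalence relations together relate every pair, one of them already does.
-/
theorem leaves_of_isTop (hS : IsMutualVisibilitySet (gluedBinaryTree r) S)
    {x x' : GluedBinaryTreeVertex r} (hx : IsTop S false x) (hx' : IsTop S true x')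
    (h : ∀ z ∈ S, side z = some false → z = x) (h' : ∀ z ∈ S, side z = some true → z = x') :
    ∃ a c, ∀ t ∈ S \ {x, x'}, a :: c <:+ word t := by
  have hleaf : ∀ t ∈ S \ {x, x'}, t ∈ S ∧ side t = none := by
    rintro t ⟨htS, ht⟩
    simp only [Set.mem_insert_iff, Set.mem_singleton_iff, not_or] at ht
    rcases side_cases true t with hs | hs | hs
    · exact absurd (h' t htS hs) ht.2
    · exact absurd (h t htS hs) ht.1
    · exact ⟨htS, hs⟩
  have hE : ∀ s t, s ∈ S ∧ side s = none → t ∈ S ∧ side t = none →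
      SameSide (word x) (word s) (word t) ∨ SameSide (word x') (word s) (word t) := by
    intro s t hs ht
    obtain ⟨b, hb⟩ := exists_copy_of_leaves hS hs.1 ht.1 hs.2 ht.2
    cases b with
    | false => exact Or.inl (hb x hx.1 hx.2.1)
    | true => exact Or.inr (hb x' hx'.1 hx'.2.1)
  obtain ⟨hxS, hxb, y, hyS, hyx, hyb, hxy⟩ := hx
  obtain ⟨hxS', hxb', y', hyS', hyx', hyb', hxy'⟩ := hx'
  have hy : y ∈ S ∧ side y = none := ⟨hyS, hyb.resolve_left fun hs => hyx (h y hyS hs)⟩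
  have hy' : y' ∈ S ∧ side y' = none := ⟨hyS', hyb'.resolve_left fun hs => hyx' (h' y' hyS' hs)⟩
  obtain ⟨a, ha⟩ := exists_cons_suffix hxy (word_ne_of_ne hyx hxb hyb)
  obtain ⟨a', ha'⟩ := exists_cons_suffix hxy' (word_ne_of_ne hyx' hxb' hyb')
  by_contra hcon
  push Not at hcon
  obtain ⟨p, hp, hpa⟩ := hcon a (word x)
  obtain ⟨q, hq, hqa⟩ := hcon a' (word x')
  replace hp := hleaf p hp
  replace hq := hleaf q hq
  have n₁ : ¬ SameSide (word x) (word y) (word p) := fun hs => hpa ((hs a).1 ha)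
  have n₂ : ¬ SameSide (word x') (word y') (word q) := fun hs => hqa ((hs a').1 ha')
  have e₁ := (hE y p hy hp).resolve_left n₁
  have e₂ := (hE y' q hy' hq).resolve_right n₂
  rcases hE y y' hy hy' with e | e
  · have f₁ := (hE p y' hp hy').resolve_left fun hs => n₁ (e.trans hs.symm)
    have f₂ := (hE p q hp hq).resolve_left fun hs => n₁ ((e.trans e₂).trans hs.symm)
    exact n₂ (f₁.symm.trans f₂)
  · have f₁ := (hE q y hq hy).resolve_right fun hs => n₂ (e.symm.trans hs.symm)
    have f₂ := (hE q p hq hp).resolve_right fun hs => n₂ ((e.symm.trans e₁).trans hs.symm)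
    exact n₁ (f₁.symm.trans f₂)

theorem isThin_of_isTop_of_isTop (hS : IsMutualVisibilitySet (gluedBinaryTree r) S)
    {x x' : GluedBinaryTreeVertex r} (hx : IsTop S false x) (hx' : IsTop S true x') :
    IsThin S := by
  refine Or.inr ⟨x, x', incomparable_of false Set.sdiff_subset ?_ ?_ ?_, ?_⟩
  · rintro y ⟨-, hy⟩ c hc
    simp only [Set.mem_insert_iff, Set.mem_singleton_iff, not_or] at hy
    cases c with
    | false => exact hy.1 (hc.unique hS hx)
    | true => exact hy.2 (hc.unique hS hx')
  · rintro y ⟨hyS, hy⟩ w ⟨hwS, hw⟩ hyb hwb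
    simp only [Set.mem_insert_iff, Set.mem_singleton_iff, not_or] at hy
    exact hx.not_suffix hS hyS hyb hy.1 hwS hwb
  · rintro y ⟨hyS, hy⟩ w ⟨hwS, hw⟩ hyb hwb
    simp only [Set.mem_insert_iff, Set.mem_singleton_iff, not_or] at hy
    exact hx'.not_suffix hS hyS hyb hy.2 hwS hwb
  by_cases hz : ∃ z ∈ S, side z = some false ∧ z ≠ x
  · obtain ⟨z, hzS, hzb, hzx⟩ := hz
    obtain ⟨a, ha⟩ := hx.exists_branch hS hzS hzb hzx
    by_cases hw : ∃ w ∈ S, side w = some true ∧ w ≠ x'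
    · obtain ⟨w, hwS, hwb, hwx⟩ := hw
      obtain ⟨a', ha'⟩ := hx'.exists_branch hS hwS hwb hwx
      have hz := ha z hzS (Or.inl hzb) hzx
      have hw := ha' w hwS (Or.inl hwb) hwx
      -- Both branches contain the quasi-leaf where a geodesic from `z` to `w` crosses, so they are
      -- nested and the larger one contains everything.
      have hcomp : a :: word x <:+ a' :: word x' ∨ a' :: word x' <:+ a :: word x := by
        obtain ⟨l, hl, hlr, h₁, h₂⟩ := exists_leaf_of_cross hS hzS hwS hzb hwb
        apply List.suffix_or_suffix_of_suffix (l₃ := l)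
        · exact (h₁ x hx.1 hx.2.1 hzx.symm a).1 hz
        · exact (h₂ x' hx'.1 hx'.2.1 hwx.symm a').1 hw
      rcases hcomp with hcomp | hcomp
      · refine ⟨a, word x, ?_⟩
        rintro t ⟨htS, ht⟩
        simp only [Set.mem_insert_iff, Set.mem_singleton_iff, not_or] at ht
        rcases side_cases false t with hs | hs | hs
        · exact ha t htS (Or.inl hs) ht.1
        · exact hcomp.trans (ha' t htS (Or.inl hs) ht.2)
        · exact ha t htS (Or.inr hs) ht.1
      · refine ⟨a', word x', ?_⟩
        rintro t ⟨htS, ht⟩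
        simp only [Set.mem_insert_iff, Set.mem_singleton_iff, not_or] at ht
        rcases side_cases false t with hs | hs | hs
        · exact hcomp.trans (ha t htS (Or.inl hs) ht.1)
        · exact ha' t htS (Or.inl hs) ht.2
        · exact ha' t htS (Or.inr hs) ht.2
    · push Not at hw
      refine ⟨a, word x, ?_⟩
      rintro t ⟨htS, ht⟩
      simp only [Set.mem_insert_iff, Set.mem_singleton_iff, not_or] at ht
      rcases side_cases false t with hs | hs | hs
      · exact ha t htS (Or.inl hs) ht.1
      · exact absurd (hw t htS hs) ht.2
      · exact ha t htS (Or.inr hs) ht.1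
  · push Not at hz
    by_cases hw : ∃ w ∈ S, side w = some true ∧ w ≠ x'
    · obtain ⟨w, hwS, hwb, hwx⟩ := hw
      obtain ⟨a', ha'⟩ := hx'.exists_branch hS hwS hwb hwx
      refine ⟨a', word x', ?_⟩
      rintro t ⟨htS, ht⟩
      simp only [Set.mem_insert_iff, Set.mem_singleton_iff, not_or] at ht
      rcases side_cases false t with hs | hs | hs
      · exact absurd (hz t htS hs) ht.1
      · exact ha' t htS (Or.inl hs) ht.2
      · exact ha' t htS (Or.inr hs) ht.2
    · push Not at hw
      exact leaves_of_isTop hS hx hx' hz hw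

theorem isThin_of_isMutualVisibilitySet (hS : IsMutualVisibilitySet (gluedBinaryTree r) S) :
    IsThin S := by
  by_cases h₀ : ∃ x, IsTop S false x
  · obtain ⟨x, hx⟩ := h₀
    by_cases h₁ : ∃ x, IsTop S true x
    · exact isThin_of_isTop_of_isTop hS hx h₁.choose_spec
    · push Not at h₁
      exact isThin_of_isTop_of_not_isTop hS hx h₁
  · push Not at h₀
    by_cases h₁ : ∃ x, IsTop S true x
    · exact isThin_of_isTop_of_not_isTop hS h₁.choose_spec h₀
    · push Not at h₁
      exact Or.inl (exists_incomparable_of_forall_not_isTop hS fun b => by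
        cases b with
        | false => exact h₀
        | true => exact h₁)

end Structure

-- Kraft's inequality and the lower bound on the number of colors.

section Weights

variable {r : ℕ}

/-- The words of length `n` below `t`. -/
def below (n : ℕ) (t : List (Fin 2)) : Finset (List (Fin 2)) :=
  (Finset.univ : Finset (List.Vector (Fin 2) (n - t.length))).image fun l => l.1 ++ t

theorem mem_below {n : ℕ} {t l : List (Fin 2)} (h : t.length ≤ n) :
    l ∈ below n t ↔ l.length = n ∧ t <:+ l := by
  simp only [below, Finset.mem_image, Finset.mem_univ, true_and]
  constructor
  · rintro ⟨v, rfl⟩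
    have := v.2
    exact ⟨by rw [List.length_append]; omega, List.suffix_append _ _⟩
  · rintro ⟨hl, s, rfl⟩
    rw [List.length_append] at hl
    exact ⟨⟨s, by omega⟩, rfl⟩

theorem card_below (n : ℕ) (t : List (Fin 2)) : (below n t).card = 2 ^ (n - t.length) := by
  rw [below, Finset.card_image_of_injective, Finset.card_univ, card_vector, Fintype.card_fin]
  intro v w h
  exact Subtype.ext (List.append_cancel_right h)

/-- Kraft's inequality for incomparable words below a common word. -/
theorem sum_le_of_incomparable {F : Finset (GluedBinaryTreeVertex r)} 
    (hF : Incomparable (F : Set (GluedBinaryTreeVertex r)))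
    {c : List (Fin 2)} (hc : c.length ≤ r) (h : ∀ x ∈ F, c <:+ word x) :
    ∑ x ∈ F, 2 ^ (r - (word x).length) ≤ 2 ^ (r - c.length) := by
  classical
  rw [← card_below, Finset.sum_congr rfl fun x _ => (card_below r (word x)).symm,
    ← Finset.card_biUnion]
  · apply Finset.card_le_card
    intro l hl
    obtain ⟨x, hx, hxl⟩ := Finset.mem_biUnion.1 hl
    rw [mem_below (word_length_le x)] at hxl
    exact (mem_below hc).2 ⟨hxl.1, (h x hx).trans hxl.2⟩
  · intro x hx y hy hne
    rw [Function.onFun, Finset.disjoint_left]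
    intro l hlx hly
    rw [mem_below (word_length_le _)] at hlx hly
    rcases List.suffix_or_suffix_of_suffix hlx.2 hly.2 with h | h
    · exact hF hx hy hne h
    · exact hF hy hx hne.symm h

/-- The number of quasi-leaves below a vertex after moving it down to depth at least `j`. -/
def weight (j : ℕ) (x : GluedBinaryTreeVertex r) : ℕ := 2 ^ (r - max (word x).length j)

theorem weight_le (j : ℕ) (x : GluedBinaryTreeVertex r) : weight j x ≤ 2 ^ (r - j) :=
  Nat.pow_le_pow_right two_pos (by omega)

theorem sum_le_add_sum_sdiff {V : Type*} [DecidableEq V] (F : Finset V) (f : V → ℕ) (x : V) :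
    ∑ y ∈ F, f y ≤ f x + ∑ y ∈ F \ {x}, f y := by
  rw [← Finset.sum_sdiff (s₁ := F ∩ {x}) Finset.inter_subset_left, Finset.sdiff_inter_self_left,
    add_comm]
  refine Nat.add_le_add_right ?_ _
  refine (Finset.sum_le_sum_of_subset Finset.inter_subset_right).trans ?_
  simp

theorem sum_weight_le {F : Finset (GluedBinaryTreeVertex r)} {j : ℕ} (hj : 1 ≤ j) (hjr : j ≤ r)
    (hF : IsMutualVisibilitySet (gluedBinaryTree r) (F : Set (GluedBinaryTreeVertex r))) :
    ∑ x ∈ F, weight j x ≤ 2 ^ r + 2 ^ (r - j) := by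
  classical
  have hw : ∀ R : Finset (GluedBinaryTreeVertex r),
      ∑ x ∈ R, weight j x ≤ ∑ x ∈ R, 2 ^ (r - (word x).length) := fun R =>
    Finset.sum_le_sum fun x _ => Nat.pow_le_pow_right two_pos (by omega)
  rcases isThin_of_isMutualVisibilitySet hF with ⟨x, hx⟩ | ⟨x, y, hxy, a, c, hc⟩
  · have h₁ := sum_le_add_sum_sdiff F (weight j) x
    have h₂ := sum_le_of_incomparable (F := F \ {x}) (c := []) (by simpa using hx)
      (Nat.zero_le r) fun _ _ => List.nil_suffix
    have h₃ := weight_le j x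
    have h₄ := hw (F \ {x})
    simp only [List.length_nil, Nat.sub_zero] at h₂
    omega
  · have h₁ := sum_le_add_sum_sdiff F (weight j) x
    have h₂ := sum_le_add_sum_sdiff (F \ {x}) (weight j) y
    have h₃ := weight_le j x
    have h₄ := weight_le j y
    have e : (F \ {x}) \ {y} = F \ {x, y} := by ext; simp [and_assoc]
    rw [e] at h₂
    have h₅ := hw (F \ {x, y})
    have hr : 2 ^ r = 2 * 2 ^ (r - 1) := by
      rw [← pow_succ', Nat.sub_add_cancel (hj.trans hjr)]
    have h₆ : 2 ^ (r - j) ≤ 2 ^ (r - 1) := Nat.pow_le_pow_right two_pos (by omega)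
    -- The half lost by lying below a nonempty word pays for the second exceptional vertex, whose
    -- weight is at most `2 ^ (r - 1)` because `1 ≤ j`.
    have h₇ : ∑ x ∈ F \ {x, y}, 2 ^ (r - (word x).length) ≤ 2 ^ (r - 1) := by
      rcases (F \ {x, y}).eq_empty_or_nonempty with h | ⟨z, hz⟩
      · rw [h]; simp
      · have hca := (hc z (by simpa using hz)).length_le.trans (word_length_le z)
        refine (sum_le_of_incomparable (by simpa using hxy) hca
          fun z hz => hc z (by simpa using hz)).trans ?_
        exact Nat.pow_le_pow_right two_pos (by simp only [List.length_cons]; omega)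
    omega

/-- The vertices, sorted by copies and depths. -/
def vertexEquiv (r : ℕ) : GluedBinaryTreeVertex r ≃
    (Bool × Σ d : Fin r, List.Vector (Fin 2) d) ⊕ List.Vector (Fin 2) r where
  toFun
    | .inner b w h => .inl (b, ⟨⟨w.length, h⟩, ⟨w, rfl⟩⟩)
    | .quasiLeaf w h => .inr ⟨w, h⟩
  invFun
    | .inl (b, ⟨d, v⟩) => .inner b v.1 (v.2.symm ▸ d.2)
    | .inr v => .quasiLeaf v.1 v.2
  left_inv x := by cases x <;> rfl
  right_inv x := by
    rcases x with ⟨b, ⟨d, hd⟩, ⟨v, hv⟩⟩ | v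
    · change v.length = d at hv
      subst hv
      rfl
    · rfl

noncomputable instance : Fintype (GluedBinaryTreeVertex r) := Fintype.ofEquiv _ (vertexEquiv r).symm

/-- Each of the `R` levels from depth `j` on weighs `2 ^ (j + R)`; the `2 ^ j - 1` vertices above
weigh `2 ^ R` each. -/
theorem sum_depths (j R : ℕ) :
    ∑ d ∈ Finset.range (j + R), 2 ^ d * 2 ^ (j + R - max d j) + 2 ^ R =
      2 ^ (j + R) + R * 2 ^ (j + R) := by
  have h₁ : ∀ d ∈ Finset.range j, 2 ^ d * 2 ^ (j + R - max d j) = 2 ^ d * 2 ^ R := fun d hd => by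
    rw [Finset.mem_range] at hd
    rw [max_eq_right hd.le, Nat.add_sub_cancel_left]
  have h₂ : ∀ d ∈ Finset.range R, 2 ^ (j + d) * 2 ^ (j + R - max (j + d) j) = 2 ^ (j + R) :=
    fun d hd => by
      rw [Finset.mem_range] at hd
      rw [← pow_add]
      congr 1
      omega
  rw [Finset.sum_range_add, Finset.sum_congr rfl h₁, Finset.sum_congr rfl h₂, ← Finset.sum_mul,
    Finset.sum_const, Finset.card_range, smul_eq_mul]
  have h₃ := Nat.geomSum_eq (le_refl 2) j
  rw [Nat.div_one] at h₃
  have h₄ : 1 ≤ 2 ^ j := Nat.one_le_two_pow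
  rw [h₃, pow_add]
  obtain ⟨N, hN⟩ := Nat.exists_eq_add_of_le h₄
  rw [hN, Nat.add_sub_cancel_left]
  ring

theorem sum_weight_univ {j : ℕ} (hjr : j ≤ r) :
    ∑ x : GluedBinaryTreeVertex r, weight j x + 2 * 2 ^ (r - j) =
      (2 * (r - j) + 3) * 2 ^ r := by
  obtain ⟨R, rfl⟩ := Nat.exists_eq_add_of_le hjr
  have h := sum_depths j R
  have h₁ : ∀ d : Fin (j + R), ∑ v : List.Vector (Fin 2) d, 2 ^ (j + R - max v.1.length j) =
      2 ^ (d : ℕ) * 2 ^ (j + R - max (d : ℕ) j) := fun d => by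
    rw [Finset.sum_congr rfl fun (v : List.Vector (Fin 2) d) _ => by rw [v.2]]
    rw [Finset.sum_const, Finset.card_univ, card_vector, Fintype.card_fin, smul_eq_mul]
  have h₂ : ∑ v : List.Vector (Fin 2) (j + R), 2 ^ (j + R - max v.1.length j) = 2 ^ (j + R) := by
    rw [Finset.sum_congr rfl fun (v : List.Vector (Fin 2) (j + R)) _ => by
      rw [v.2, max_eq_left hjr, Nat.sub_self, pow_zero]]
    simp [card_vector]
  rw [← (vertexEquiv (j + R)).symm.sum_comp, Fintype.sum_sum_type, Fintype.sum_prod_type]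
  simp only [Fintype.sum_bool, Fintype.sum_sigma]
  change ∑ d : Fin (j + R), ∑ v : List.Vector (Fin 2) d, 2 ^ (j + R - max v.1.length j) +
    ∑ d : Fin (j + R), ∑ v : List.Vector (Fin 2) d, 2 ^ (j + R - max v.1.length j) +
    ∑ v : List.Vector (Fin 2) (j + R), 2 ^ (j + R - max v.1.length j) + _ = _
  rw [h₂, Finset.sum_congr rfl fun d _ => h₁ d,
    Fin.sum_univ_eq_sum_range (fun d => 2 ^ d * 2 ^ (j + R - max d j)), Nat.add_sub_cancel_left]
  linarith

/-- Counting weights over the color classes. -/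
theorem le_mul_of_coloring {j k : ℕ} (hj : 1 ≤ j) (hjr : j ≤ r)
    {c : GluedBinaryTreeVertex r → Fin k} (hc : IsMutualVisibilityColoring (gluedBinaryTree r) c) :
    (2 * (r - j) + 3) * 2 ^ j ≤ k * (2 ^ j + 1) + 2 := by
  classical
  have h : ∑ x : GluedBinaryTreeVertex r, weight j x ≤ k * (2 ^ r + 2 ^ (r - j)) := by
    rw [← Finset.sum_fiberwise_of_maps_to (s := Finset.univ) (t := Finset.univ) (g := c)
      fun _ _ => Finset.mem_univ _]
    refine (Finset.sum_le_card_nsmul _ _ (2 ^ r + 2 ^ (r - j)) fun a _ => ?_).trans (by simp)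
    apply sum_weight_le hj hjr
    have := hc a
    simpa using this
  have hu := sum_weight_univ hjr
  have e : 2 ^ r = 2 ^ j * 2 ^ (r - j) := by rw [← pow_add, Nat.add_sub_cancel' hjr]
  have hpos : 0 < 2 ^ (r - j) := by positivity
  refine Nat.le_of_mul_le_mul_right (c := 2 ^ (r - j)) ?_ hpos
  rw [e] at h hu
  linarith

end Weights

-- Constructing mutual-visibility sets.

section Visibility

variable {r : ℕ} {S : Set (GluedBinaryTreeVertex r)}

/-- Some shortest path from `x` to `y` has no internal vertex in `S`. -/
def Visible {V : Type*} (G : SimpleGraph V) (S : Set V) (x y : V) : Prop :=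
  ∃ p : G.Walk x y, p.length = G.dist x y ∧ ∀ z ∈ p.support, z ≠ x → z ≠ y → z ∉ S

theorem Visible.refl {V : Type*} (G : SimpleGraph V) (S : Set V) (x : V) : Visible G S x x :=
  ⟨.nil, by simp, fun z hz h => absurd (by simpa using hz) h⟩

theorem Visible.symm {V : Type*} {G : SimpleGraph V} {S : Set V} {x y : V}
    (h : Visible G S x y) : Visible G S y x := by
  obtain ⟨p, hp, hps⟩ := h
  refine ⟨p.reverse, by rw [SimpleGraph.Walk.length_reverse, hp, SimpleGraph.dist_comm],
    fun z hz hy hx => hps z ?_ hx hy⟩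
  rwa [SimpleGraph.Walk.support_reverse, List.mem_reverse] at hz

theorem length_eq_dist_of_forall_le {V : Type*} {G : SimpleGraph V} {x y : V} (p : G.Walk x y)
    (h : ∀ q : G.Walk x y, p.length ≤ q.length) : p.length = G.dist x y := by
  obtain ⟨q, hq⟩ := p.reachable.exists_walk_length_eq_dist
  exact le_antisymm (hq ▸ h q) (SimpleGraph.dist_le p)

theorem visible_of_tree_walk {x y : GluedBinaryTreeVertex r} (b : Bool)
    (hx : side x = some b ∨ side x = none) (hy : side y = some b ∨ side y = none)
    (h : ∀ z ∈ S, (side z = some b ∨ side z = none) → (word z <:+ word x ∨ word z <:+ word y) →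
      meet (word x) (word y) ≤ (word z).length → z = x ∨ z = y) :
    Visible (gluedBinaryTree r) S x y := by
  obtain ⟨p, hp, hps⟩ := exists_tree_walk b (word_length_le x) (word_length_le y)
  rw [eq_node hx, eq_node hy]
  refine ⟨p, length_eq_dist_of_forall_le p fun q => ?_, fun z hz hzx hzy hzS => ?_⟩
  · have := wordDist_le_length q
    rwa [word_node, word_node, ← hp] at this
  · obtain ⟨s, hs, rfl, h₁, h₂⟩ := hps z hz
    rw [← eq_node hx] at hzx
    rw [← eq_node hy] at hzy
    rcases h _ hzS (side_node _ _ _) (by simpa using h₁) (by simpa using h₂) with h | h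
    · exact hzx h
    · exact hzy h

/-- The crossing at a quasi-leaf below `y` is shortest because `y` is at least as deep as `x`. In
the copy of `x` the route leads to that quasi-leaf, and in the other copy it only climbs up to `y`.
-/
theorem visible_of_cross_walk {x y : GluedBinaryTreeVertex r} {b : Bool}
    (hx : side x = some b) (hy : side y = some (!b)) (hle : (word x).length ≤ (word y).length)
    (h₁ : ∀ l : List (Fin 2), word y <:+ l → l.length = r →
      ∀ z ∈ S, (side z = some b ∨ side z = none) → (word z <:+ word x ∨ word z <:+ l) → z = x)
    (h₂ : ∀ z ∈ S, side z = some (!b) → word y <:+ word z → z = y) :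
    Visible (gluedBinaryTree r) S x y := by
  obtain ⟨l, hl, hv⟩ := exists_leaf_below (word_length_le y)
  obtain ⟨p, hp, hps⟩ := exists_cross_walk b (word_length_le x) hl hv
  have ex := eq_node (Or.inl hx)
  have ey := eq_node (Or.inl hy)
  have hlen : ∀ q : (gluedBinaryTree r).Walk x y, p.length ≤ q.length := fun q => by
    have d₁ := le_length_cross hx hy q
    have d₂ := wordDist_leaf_le (u := word x) hl hv
    rw [max_eq_right hle] at d₁
    omega
  refine ⟨p.copy ex.symm ey.symm, length_eq_dist_of_forall_le _ fun q => ?_,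
    fun z hz hzx hzy hzS => ?_⟩
  · rw [SimpleGraph.Walk.length_copy]
    exact hlen q
  · rw [SimpleGraph.Walk.support_copy] at hz
    obtain ⟨s, hs, ⟨rfl, h, -⟩ | ⟨rfl, h, h'⟩⟩ := hps z hz
    · exact hzx (h₁ l hv hl _ hzS (side_node _ _ _) (by simpa using h))
    · rcases side_node (!b) s hs with hs' | hs'
      · exact hzy (h₂ _ hzS hs' (by simpa using h))
      · have hsl : s = l := h'.eq_of_length (by
          have := word_length_eq hs'
          rw [word_node] at this
          omega)
        exact hzx (h₁ l hv hl _ hzS (Or.inr hs') (by simp [hsl]))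

/-- Vertices of one level never block each other within their copy, and the copy of the single added
vertex contains nothing else of `S`. -/
theorem isMutualVisibilitySet_level {b : Bool} {k : ℕ}
    (h : ∀ x ∈ S, (side x = some b ∧ (word x).length = k) ∨
      (side x = some (!b) ∧ (word x).length ≤ k))
    (hu : ∀ x ∈ S, ∀ y ∈ S, side x = some (!b) → side y = some (!b) → x = y) :
    IsMutualVisibilitySet (gluedBinaryTree r) S := by
  have hne : ∀ x ∈ S, side x ≠ none := fun x hx hs => by
    rcases h x hx with h | h <;> rw [hs] at h <;> cases h.1
  have hk : ∀ x ∈ S, side x = some b → (word x).length = k := fun x hx hs => by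
    rcases h x hx with h | h
    · exact h.2
    · rw [hs] at h; cases b <;> simp at h
  have key : ∀ x ∈ S, ∀ y ∈ S, side x = some (!b) → (word x).length ≤ k →
      side y = some b → Visible (gluedBinaryTree r) S x y := by
    intro x hxS y hyS hx hxk hy
    refine visible_of_cross_walk hx (by simpa using hy) (hk y hyS hy ▸ hxk) ?_ ?_
    · intro l _ _ z hz hzb _
      exact hu z hz x hxS (hzb.resolve_right (hne z hz)) hx
    · intro z hz hzb hyz
      rw [Bool.not_not] at hzb
      exact (eq_of_side_word (hy.trans hzb.symm)
        (hyz.eq_of_length ((hk y hyS hy).trans (hk z hz hzb).symm))).symm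
  intro x hx y hy
  rcases h x hx with ⟨hxb, hxk⟩ | ⟨hxb, hxk⟩ <;> rcases h y hy with ⟨hyb, hyk⟩ | ⟨hyb, hyk⟩
  · refine visible_of_tree_walk b (Or.inl hxb) (Or.inl hyb) fun z hz hzb hzxy _ => ?_
    have hzb := hzb.resolve_right (hne z hz)
    have hzk := hk z hz hzb
    rcases hzxy with hzx | hzy
    · exact Or.inl (eq_of_side_word (hzb.trans hxb.symm) (hzx.eq_of_length (hzk.trans hxk.symm)))
    · exact Or.inr (eq_of_side_word (hzb.trans hyb.symm) (hzy.eq_of_length (hzk.trans hyk.symm)))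
  · exact (key y hy x hx hyb hyk hxb).symm
  · exact key x hx y hy hxb hxk hyb
  · exact hu x hx y hy hxb hyb ▸ Visible.refl _ _ _

theorem eq_of_suffix_of_leaf {x z : GluedBinaryTreeVertex r} (hz : side z = none)
    (h : word z <:+ word x) : z = x := by
  have e : word z = word x := h.eq_of_length_le (by rw [word_length_eq hz]; exact word_length_le x)
  refine eq_of_side_word ?_ e
  cases hx : side x with
  | none => exact hz
  | some b =>
    have h₁ := word_length_lt hx
    have h₂ := word_length_eq hz
    rw [e] at h₂
    omega

theorem isMutualVisibilitySet_leaves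
    (h : ∀ x ∈ S, side x = none ∨ (side x = some false ∧ word x = [])) :
    IsMutualVisibilitySet (gluedBinaryTree r) S := by
  have key : ∀ x ∈ S, ∀ y ∈ S, side x = some false ∧ word x = [] → side y = none →
      Visible (gluedBinaryTree r) S x y := by
    intro x hxS y hyS hx hy
    refine visible_of_tree_walk false (Or.inl hx.1) (Or.inr hy) fun z hz hzb hzxy _ => ?_
    rcases h z hz with hs | hs
    · exact hzxy.imp (eq_of_suffix_of_leaf hs) (eq_of_suffix_of_leaf hs)
    · exact Or.inl (eq_of_side_word (hs.1.trans hx.1.symm) (hs.2.trans hx.2.symm))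
  intro x hx y hy
  rcases h x hx with hxs | hxs <;> rcases h y hy with hys | hys
  -- Two quasi-leaves are joined through the second copy, away from the root of the first, which may
  -- belong to `S`.
  · refine visible_of_tree_walk true (Or.inr hxs) (Or.inr hys) fun z hz hzb hzxy _ => ?_
    have hs : side z = none := by
      rcases h z hz with hs | hs
      · exact hs
      · rw [hs.1] at hzb; simp at hzb
    exact hzxy.imp (eq_of_suffix_of_leaf hs) (eq_of_suffix_of_leaf hs)
  · exact (key y hy x hx hys hxs).symm
  · exact key x hx y hy hxs hys
  · have : x = y := eq_of_side_word (hxs.1.trans hys.1.symm) (hxs.2.trans hys.2.symm)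
    exact this ▸ Visible.refl _ _ _

theorem eq_of_singleton_suffix {α : Type*} {a c : α} {w : List α} (h : [a] <:+ w)
    (h' : [c] <:+ w) : a = c := by
  have := (List.suffix_of_suffix_length_le h h' le_rfl).eq_of_length rfl
  simpa using this

/-- The two halves of level `m` lie below different children of the root. So in either copy the
subtree under a member of the other copy is free of level-`m` members, and crossings there are not
blocked. The root of the second copy does not separate members of that copy, as they all lie below
its child `[0]`. -/
theorem isMutualVisibilitySet_mixed {m : ℕ} (hm : 1 ≤ m)
    (h : ∀ x ∈ S, (side x = some false ∧ (word x).length = m ∧ [1] <:+ word x) ∨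
      (side x = some true ∧ (word x).length = m ∧ [0] <:+ word x) ∨
      (side x = some true ∧ word x = [])) :
    IsMutualVisibilitySet (gluedBinaryTree r) S := by
  have hne : ∀ z ∈ S, side z ≠ none := by
    intro z hz hs
    rcases h z hz with h | h | h <;> rw [hs] at h <;> cases h.1
  have hf : ∀ z ∈ S, side z = some false → (word z).length = m ∧ [1] <:+ word z := by
    intro z hz hs
    rcases h z hz with h | h | h
    · exact h.2
    · rw [hs] at h; simp at h
    · rw [hs] at h; simp at h
  have ht : ∀ z ∈ S, side z = some true →
      ((word z).length = m ∧ [0] <:+ word z) ∨ word z = [] := by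
    intro z hz hs
    rcases h z hz with h | h | h
    · rw [hs] at h; simp at h
    · exact Or.inl h.2
    · exact Or.inr h.2
  have heq : ∀ {z x : GluedBinaryTreeVertex r} {b : Bool}, side z = some b → side x = some b →
      (word z).length = m → (word x).length = m → word z <:+ word x → z = x :=
    fun hz hx hzm hxm hzx => eq_of_side_word (hz.trans hx.symm)
      (hzx.eq_of_length (hzm.trans hxm.symm))
  have hdisj : ∀ {u v l : List (Fin 2)}, u.length = m → v.length = m → [1] <:+ u → [0] <:+ v →
      u <:+ l → v <:+ l → False := by
    intro u v l hu hv hu₁ hv₀ hul hvl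
    have := (List.suffix_of_suffix_length_le hul hvl (hu.trans hv.symm).le).eq_of_length
      (hu.trans hv.symm)
    subst this
    exact absurd (eq_of_singleton_suffix hu₁ hv₀) (by decide)
  have hnil : ∀ {u : List (Fin 2)}, u.length = m → ¬ u <:+ [] := by
    intro u hu hu'
    rw [List.suffix_nil.1 hu'] at hu
    simp at hu
    omega
  have kAB : ∀ x ∈ S, ∀ y ∈ S, side x = some false → side y = some true →
      (word y).length = m → [0] <:+ word y → Visible (gluedBinaryTree r) S x y := by
    intro x hxS y hyS hx hy hym hy₀
    obtain ⟨hxm, hx₁⟩ := hf x hxS hx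
    refine visible_of_cross_walk hx hy (hxm.trans hym.symm).le ?_ ?_
    · intro l hl _ z hz hzb hzxl
      have hzb := hzb.resolve_right (hne z hz)
      obtain ⟨hzm, hz₁⟩ := hf z hz hzb
      rcases hzxl with hzx | hzl
      · exact heq hzb hx hzm hxm hzx
      · exact (hdisj hzm hym hz₁ hy₀ hzl hl).elim
    · intro z hz hzb hyz
      rcases ht z hz hzb with ⟨hzm, -⟩ | hz'
      · exact (heq hy hzb hym hzm hyz).symm
      · exact (hnil hym (hz' ▸ hyz)).elim
  have kRA : ∀ x ∈ S, ∀ y ∈ S, side x = some true → word x = [] → side y = some false →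
      Visible (gluedBinaryTree r) S x y := by
    intro x hxS y hyS hx hx₀ hy
    obtain ⟨hym, hy₁⟩ := hf y hyS hy
    refine visible_of_cross_walk hx hy (by rw [hx₀]; exact Nat.zero_le _) ?_ ?_
    · intro l hl _ z hz hzb hzxl
      have hzb := hzb.resolve_right (hne z hz)
      rcases ht z hz hzb with ⟨hzm, hz₀⟩ | hz'
      · rcases hzxl with hzx | hzl
        · exact (hnil hzm (hx₀ ▸ hzx)).elim
        · exact (hdisj hym hzm hy₁ hz₀ hl hzl).elim
      · exact eq_of_side_word (hzb.trans hx.symm) (hz'.trans hx₀.symm)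
    · intro z hz hzb hyz
      obtain ⟨hzm, -⟩ := hf z hz hzb
      exact (heq hy hzb hym hzm hyz).symm
  have kRB : ∀ x ∈ S, ∀ y ∈ S, side x = some true → word x = [] → side y = some true →
      (word y).length = m → Visible (gluedBinaryTree r) S x y := by
    intro x hxS y hyS hx hx₀ hy hym
    refine visible_of_tree_walk true (Or.inl hx) (Or.inl hy) fun z hz hzb hzxy _ => ?_
    have hzb := hzb.resolve_right (hne z hz)
    rcases ht z hz hzb with ⟨hzm, hz₀⟩ | hz'
    · rcases hzxy with hzx | hzy
      · exact (hnil hzm (hx₀ ▸ hzx)).elim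
      · exact Or.inr (heq hzb hy hzm hym hzy)
    · exact Or.inl (eq_of_side_word (hzb.trans hx.symm) (hz'.trans hx₀.symm))
  intro x hx y hy
  rcases h x hx with ⟨hxb, hxm, hx'⟩ | ⟨hxb, hxm, hx'⟩ | ⟨hxb, hx'⟩ <;>
    rcases h y hy with ⟨hyb, hym, hy'⟩ | ⟨hyb, hym, hy'⟩ | ⟨hyb, hy'⟩
  · refine visible_of_tree_walk false (Or.inl hxb) (Or.inl hyb) fun z hz hzb hzxy _ => ?_
    have hzb := hzb.resolve_right (hne z hz)
    have hzm := (hf z hz hzb).1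
    exact hzxy.imp (heq hzb hxb hzm hxm) (heq hzb hyb hzm hym)
  · exact kAB x hx y hy hxb hyb hym hy'
  · exact (kRA y hy x hx hyb hy' hxb).symm
  · exact (kAB y hy x hx hyb hxb hxm hx').symm
  · refine visible_of_tree_walk true (Or.inl hxb) (Or.inl hyb) fun z hz hzb hzxy hzl => ?_
    have hzb := hzb.resolve_right (hne z hz)
    rcases ht z hz hzb with ⟨hzm, -⟩ | hz'
    · exact hzxy.imp (heq hzb hxb hzm hxm) (heq hzb hyb hzm hym)
    · have := (length_le_meet hx' hy').trans hzl
      simp [hz'] at this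
  · exact (kRB y hy x hx hyb hy' hxb hxm).symm
  · exact kRA x hx y hy hxb hx' hyb
  · exact kRB x hx y hy hxb hx' hyb hym
  · have : x = y := eq_of_side_word (hxb.trans hyb.symm) (hx'.trans hy'.symm)
    exact this ▸ Visible.refl _ _ _

end Visibility

-- Optimal colorings and the value of the chromatic number.

section Colorings

variable {r : ℕ}

theorem exists_coloring_fin {V C : Type*} {G : SimpleGraph V} {c : V → C} (T : Finset C)
    (hT : ∀ x, c x ∈ T) (hc : ∀ a ∈ T, IsMutualVisibilitySet G {v | c v = a}) :
    ∃ c' : V → Fin T.card, IsMutualVisibilityColoring G c' := by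
  refine ⟨fun v => T.equivFin ⟨c v, hT v⟩, fun a => ?_⟩
  obtain ⟨⟨a, ha⟩, rfl⟩ := T.equivFin.surjective a
  simpa using hc a ha

/-- The number with binary digits `1` followed by the letters of the word. -/
def code : List (Fin 2) → ℕ
  | [] => 1
  | a :: w => 2 * code w + a

theorem code_pos (w : List (Fin 2)) : 1 ≤ code w := by
  induction w with
  | nil => exact le_rfl
  | cons a w ih => rw [code]; omega

theorem code_injective : Function.Injective code := by
  intro u
  induction u with
  | nil =>
    intro v h
    cases v with
    | nil => rfl
    | cons a v =>
      have := code_pos v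
      rw [code, code] at h
      omega
  | cons a u ih =>
    intro v h
    cases v with
    | nil =>
      have := code_pos u
      rw [code, code] at h
      omega
    | cons b v =>
      rw [code, code] at h
      have ha := a.2
      have hb := b.2
      have h₁ : code u = code v := by omega
      have h₂ : a = b := Fin.ext (by omega)
      rw [ih h₁, h₂]

theorem code_lt (w : List (Fin 2)) : code w < 2 ^ (w.length + 1) := by
  induction w with
  | nil => simp [code]
  | cons a w ih =>
    have := a.2
    rw [code, List.length_cons, pow_succ]
    omega

/-- The binary digits start with `10`, so the code stays in the lower half of the codes of its
length. -/
theorem code_lt_of_zero_suffix {w : List (Fin 2)} (h : [0] <:+ w) :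
    2 * code w + 2 ≤ 3 * 2 ^ w.length := by
  induction w with
  | nil => simp at h
  | cons a w ih =>
    rcases List.suffix_cons_iff.1 h with h | h
    · rw [← h]; simp [code]
    · have := ih h
      have := a.2
      rw [code, List.length_cons, pow_succ]
      omega

theorem two_le_code {w : List (Fin 2)} (h : w ≠ []) : 2 ≤ code w := by
  cases w with
  | nil => exact absurd rfl h
  | cons a w =>
    have := code_pos w
    rw [code]
    omega

/-- Every vertex of depth less than `m` is added to its own level of the other copy. -/
def levelColoring (m : ℕ) : GluedBinaryTreeVertex r → (Bool × ℕ) ⊕ Bool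
  | .inner b w _ => if m ≤ w.length then .inl (b, w.length - m) else .inl (!b, code w - 1)
  | .quasiLeaf _ _ => .inr false

/-- The codes of the words shorter than `m` run through `1, …, 2 ^ m - 1`, so they need that many of
the `r - m` levels of the other copy. The quasi-leaves are the extra color. -/
theorem exists_levelColoring {m : ℕ} (h : 2 ^ m + m ≤ r + 1) :
    ∃ c : GluedBinaryTreeVertex r → Fin (2 * (r - m) + 1),
      IsMutualVisibilityColoring (gluedBinaryTree r) c := by
  have e : ((Finset.univ ×ˢ Finset.range (r - m) : Finset (Bool × ℕ)).disjSum
      {false}).card = 2 * (r - m) + 1 := by simp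
  rw [← e]
  apply exists_coloring_fin (c := levelColoring m)
  · intro x
    cases x with
    | inner b w hw =>
      simp only [levelColoring]
      split_ifs with hm
      · simp; omega
      · have h₁ := code_lt w
        have h₂ : 2 ^ (w.length + 1) ≤ 2 ^ m := Nat.pow_le_pow_right two_pos (by omega)
        have h₃ := code_pos w
        simp; omega
    | quasiLeaf w hw => simp [levelColoring]
  · rintro (⟨b, i⟩ | b) -
    · apply isMutualVisibilitySet_level (b := b) (k := i + m)
      · intro x hx
        cases x with
        | inner b' w hw =>
          simp only [levelColoring, Set.mem_ofPred_eq] at hx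
          split_ifs at hx with hm <;> simp only [Sum.inl.injEq, Prod.mk.injEq] at hx
          · exact Or.inl ⟨by simp [side, hx.1], by simp only [word]; omega⟩
          · exact Or.inr ⟨by simp [side, ← hx.1], by simp only [word]; omega⟩
        | quasiLeaf w hw => simp [levelColoring] at hx
      · intro x hx y hy hxb hyb
        refine eq_of_side_word (hxb.trans hyb.symm) (code_injective ?_)
        have key : ∀ z : GluedBinaryTreeVertex r, levelColoring m z = .inl (b, i) →
            side z = some (!b) → code (word z) = i + 1 := by
          intro z hz hzb
          cases z with
          | inner b' w hw =>
            simp only [side, Option.some.injEq] at hzb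
            subst hzb
            simp only [levelColoring] at hz
            split_ifs at hz with hm <;> simp only [Sum.inl.injEq, Prod.mk.injEq] at hz
            · exact absurd hz.1 (by cases b <;> simp)
            · have := code_pos w
              simp only [word]
              omega
          | quasiLeaf w hw => cases hzb
        rw [key x hx hxb, key y hy hyb]
    · apply isMutualVisibilitySet_leaves
      intro x hx
      cases x with
      | inner b' w hw =>
        simp only [levelColoring, Set.mem_ofPred_eq] at hx
        split_ifs at hx
      | quasiLeaf w hw => exact Or.inl rfl

/-- The words of the second copy with their letters interchanged. -/
def twist (b : Bool) (w : List (Fin 2)) : List (Fin 2) := if b then w.map Fin.rev else w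

theorem twist_injective (b : Bool) : Function.Injective (twist b) := by
  intro u v h
  cases b with
  | false => exact h
  | true => exact List.map_injective_iff.2 Fin.rev_injective h

@[simp] theorem length_twist (b : Bool) (w : List (Fin 2)) : (twist b w).length = w.length := by
  cases b <;> simp [twist]

theorem zero_suffix_twist {b : Bool} {w : List (Fin 2)} (hw : w ≠ [])
    (h : ¬ [cond b 0 1] <:+ w) : [0] <:+ twist b w := by
  obtain ⟨a, ha⟩ := exists_cons_suffix (List.nil_suffix (l := w)) hw.symm
  cases b with
  | false =>
    have : a ≠ 1 := by rintro rfl; exact h ha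
    obtain rfl : a = 0 := by omega
    exact ha
  | true =>
    have : a ≠ 0 := by rintro rfl; exact h ha
    obtain rfl : a = 1 := by omega
    exact ha.map Fin.rev

/-- Half of the level `m` of the first copy, the other half of that level of the second copy, and
the second root form one class; the first root is added to the quasi-leaves; all other vertices of
depth at most `m` are added to their own levels of the other copies. -/
def mixedColoring (m : ℕ) : GluedBinaryTreeVertex r → (Bool × ℕ) ⊕ Bool
  | .inner b w _ =>
    if m + 1 ≤ w.length then .inl (b, w.length - (m + 1))
    else if w = [] then .inr b
    else if w.length = m ∧ [cond b 0 1] <:+ w then .inr true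
    else .inl (!b, code (twist b w) - 2)
  | .quasiLeaf _ _ => .inr false

/-- Per copy, `2 ^ m - 2` non-root vertices above level `m` and half of that level remain. After
`twist` their codes run consecutively from `2` to `3 * 2 ^ (m - 1) - 1`, and `r - m - 1` levels of
the other copy must absorb them. -/
theorem exists_mixedColoring {m : ℕ} (hm : 1 ≤ m) (h : 3 * 2 ^ m + 2 * m ≤ 2 * r + 2) :
    ∃ c : GluedBinaryTreeVertex r → Fin (2 * (r - m)),
      IsMutualVisibilityColoring (gluedBinaryTree r) c := by
  have hpow : 2 ^ 1 ≤ 2 ^ m := Nat.pow_le_pow_right two_pos hm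
  have e : ((Finset.univ ×ˢ Finset.range (r - m - 1) : Finset (Bool × ℕ)).disjSum
      (Finset.univ : Finset Bool)).card = 2 * (r - m) := by simp; omega
  rw [← e]
  apply exists_coloring_fin (c := mixedColoring m)
  · intro x
    cases x with
    | inner b w hw =>
      simp only [mixedColoring]
      split_ifs with h₁ h₂ h₃
      · simp; omega
      · simp
      · simp
      · have hlt : 2 * code (twist b w) < 3 * 2 ^ m := by
          rcases Nat.lt_or_ge w.length m with hl | hl
          · have k₁ := code_lt (twist b w)
            have k₂ : 2 ^ (w.length + 1) ≤ 2 ^ m := Nat.pow_le_pow_right two_pos (by omega)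
            rw [length_twist] at k₁
            omega
          · have hl : w.length = m := by omega
            have := code_lt_of_zero_suffix (zero_suffix_twist h₂ fun h => h₃ ⟨hl, h⟩)
            rw [length_twist, hl] at this
            omega
        have h₄ : 2 ≤ code (twist b w) := two_le_code fun h => h₂ (List.eq_nil_of_length_eq_zero
          (by rw [← length_twist b, h, List.length_nil]))
        simp; omega
    | quasiLeaf w hw => simp [mixedColoring]
  · rintro (⟨b, i⟩ | b) -
    · apply isMutualVisibilitySet_level (b := b) (k := i + (m + 1))
      · intro x hx
        cases x with
        | inner b' w hw =>
          simp only [mixedColoring, Set.mem_ofPred_eq] at hx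
          split_ifs at hx with h₁ h₂ h₃ <;> simp only [Sum.inl.injEq, Prod.mk.injEq] at hx
          · exact Or.inl ⟨by simp [side, hx.1], by simp only [word]; omega⟩
          · exact Or.inr ⟨by simp [side, ← hx.1], by simp only [word]; omega⟩
        | quasiLeaf w hw => simp [mixedColoring] at hx
      · intro x hx y hy hxb hyb
        refine eq_of_side_word (hxb.trans hyb.symm) (twist_injective (!b) (code_injective ?_))
        have key : ∀ z : GluedBinaryTreeVertex r, mixedColoring m z = .inl (b, i) →
            side z = some (!b) → code (twist (!b) (word z)) = i + 2 := by
          intro z hz hzb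
          cases z with
          | inner b' w hw =>
            simp only [side, Option.some.injEq] at hzb
            subst hzb
            simp only [mixedColoring] at hz
            split_ifs at hz with h₁ h₂ h₃ <;> simp only [Sum.inl.injEq, Prod.mk.injEq] at hz
            · exact absurd hz.1 (by cases b <;> simp)
            · have : 2 ≤ code (twist (!b) w) := two_le_code fun h =>
                h₂ (List.eq_nil_of_length_eq_zero (by rw [← length_twist (!b), h, List.length_nil]))
              simp only [word]
              omega
          | quasiLeaf w hw => cases hzb
        rw [key x hx hxb, key y hy hyb]
    · cases b with
      | false =>
        apply isMutualVisibilitySet_leaves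
        intro x hx
        cases x with
        | inner b' w hw =>
          simp only [mixedColoring, Set.mem_ofPred_eq] at hx
          split_ifs at hx with h₁ h₂ h₃
          · simp only [Sum.inr.injEq] at hx
            exact Or.inr ⟨by simp [side, hx], h₂⟩
          · simp at hx
        | quasiLeaf w hw => exact Or.inl rfl
      | true =>
        apply isMutualVisibilitySet_mixed hm
        intro x hx
        cases x with
        | inner b' w hw =>
          simp only [mixedColoring, Set.mem_ofPred_eq] at hx
          split_ifs at hx with h₁ h₂ h₃
          · simp only [Sum.inr.injEq] at hx
            exact Or.inr (Or.inr ⟨by simp [side, hx], h₂⟩)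
          · cases b' with
            | false => exact Or.inl ⟨rfl, h₃⟩
            | true => exact Or.inr (Or.inl ⟨rfl, h₃⟩)
        | quasiLeaf w hw => simp [mixedColoring] at hx

theorem chromaticNumber_eq {k : ℕ}
    (h : ∃ c : GluedBinaryTreeVertex r → Fin k, IsMutualVisibilityColoring (gluedBinaryTree r) c)
    (h' : ∀ k', (∃ c : GluedBinaryTreeVertex r → Fin k',
      IsMutualVisibilityColoring (gluedBinaryTree r) c) → k ≤ k') :
    mutualVisibilityChromaticNumber (gluedBinaryTree r) = k :=
  le_antisymm (Nat.sInf_le h) (le_csInf ⟨k, h⟩ h')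

theorem chromaticNumber_of_lower_half {m : ℕ} (hm : 1 ≤ m) (h₁ : 2 ^ m + m ≤ r + 1)
    (h₂ : 2 * r + 4 ≤ 3 * 2 ^ m + 2 * m) :
    mutualVisibilityChromaticNumber (gluedBinaryTree r) = 2 * (r - m) + 1 := by
  refine chromaticNumber_eq (exists_levelColoring h₁) ?_
  rintro k ⟨c, hc⟩
  have hpow : 1 ≤ 2 ^ m := Nat.one_le_two_pow
  obtain ⟨R, rfl⟩ := Nat.exists_eq_add_of_le (show m ≤ r by omega)
  have := le_mul_of_coloring hm (Nat.le_add_right m R) hc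
  rw [Nat.add_sub_cancel_left] at *
  by_contra hlt
  -- With `k ≤ 2 * R` the weight count would give `3 * 2 ^ m ≤ 2 * R + 2`, against `h₂`.
  have : k * (2 ^ m + 1) ≤ 2 * R * (2 ^ m + 1) := Nat.mul_le_mul_right _ (by omega)
  nlinarith

theorem chromaticNumber_of_upper_half {m : ℕ} (hm : 1 ≤ m)
    (h₁ : 3 * 2 ^ m + 2 * m ≤ 2 * r + 2) (h₂ : r + 1 ≤ 2 * 2 ^ m + m) :
    mutualVisibilityChromaticNumber (gluedBinaryTree r) = 2 * (r - m) := by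
  refine chromaticNumber_eq (exists_mixedColoring hm h₁) ?_
  rintro k ⟨c, hc⟩
  have hpow : 1 ≤ 2 ^ m := Nat.one_le_two_pow
  obtain ⟨R, rfl⟩ := Nat.exists_eq_add_of_le (show m ≤ r by omega)
  have := le_mul_of_coloring hm (Nat.le_add_right m R) hc
  rw [Nat.add_sub_cancel_left] at *
  by_contra hlt
  -- With `k + 1 ≤ 2 * R` the weight count would give `4 * 2 ^ m ≤ 2 * R + 1`, against `h₂`.
  have : (k + 1) * (2 ^ m + 1) ≤ 2 * R * (2 ^ m + 1) := Nat.mul_le_mul_right _ (by omega)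
  nlinarith

end Colorings

-- The ranges of `r`, translated from integer `i` to natural `m = i - 1`.

section Ranges

variable {r : ℕ}

theorem two_le_of_le_zpow (hr : 2 ≤ r) {i : ℤ} (h : (r : ℚ) ≤ (2 : ℚ) ^ i + i - 2) : 2 ≤ i := by
  by_contra hi
  have h₁ : (2 : ℚ) ^ i ≤ (2 : ℚ) ^ (1 : ℤ) := zpow_le_zpow_right₀ (by norm_num) (by omega)
  have h₂ : (i : ℚ) ≤ 1 := by exact_mod_cast (show i ≤ 1 by omega)
  have h₃ : (2 : ℚ) ≤ r := by exact_mod_cast hr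
  rw [zpow_one] at h₁
  linarith

theorem exists_nat_eq {i : ℤ} (h : 2 ≤ i) : ∃ m : ℕ, 1 ≤ m ∧ i = m + 1 :=
  ⟨(i - 1).toNat, by omega, by omega⟩

theorem zpow_range_iff {m : ℕ} :
    ((2 : ℚ) ^ ((m + 1 : ℤ) - 1) + (m + 1 : ℤ) - 2 ≤ r ∧
      (r : ℚ) ≤ (2 : ℚ) ^ (m + 1 : ℤ) + (m + 1 : ℤ) - 2) ↔
    2 ^ m + m ≤ r + 1 ∧ r + 1 ≤ 2 ^ (m + 1) + m := by
  rw [add_sub_cancel_right, zpow_natCast, zpow_add_one₀ two_ne_zero, zpow_natCast, pow_succ]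
  push_cast
  constructor
  · rintro ⟨h₁, h₂⟩
    constructor
    · have : ((2 : ℚ) ^ m + m) ≤ r + 1 := by linarith
      exact_mod_cast this
    · have : (r : ℚ) + 1 ≤ 2 ^ m * 2 + m := by linarith
      exact_mod_cast this
  · rintro ⟨h₁, h₂⟩
    have h₁ : ((2 : ℚ) ^ m + m) ≤ r + 1 := by exact_mod_cast h₁
    have h₂ : (r : ℚ) + 1 ≤ 2 ^ m * 2 + m := by exact_mod_cast h₂
    constructor <;> linarith

theorem exists_range (hr : 2 ≤ r) :
    ∃ m : ℕ, 1 ≤ m ∧ 2 ^ m + m ≤ r + 1 ∧ r + 1 ≤ 2 ^ (m + 1) + m := by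
  classical
  let P := fun m : ℕ => 2 ^ m + m ≤ r + 1
  have hP : P 1 := by change 2 ^ 1 + 1 ≤ r + 1; omega
  have h₁ : 1 ≤ Nat.findGreatest P (r + 1) := Nat.le_findGreatest (by omega) hP
  have h₂ : P (Nat.findGreatest P (r + 1)) := Nat.findGreatest_spec (by omega) hP
  refine ⟨Nat.findGreatest P (r + 1), h₁, h₂, ?_⟩
  by_contra hlt
  have h₃ : P (Nat.findGreatest P (r + 1) + 1) := by
    change 2 ^ (_ + 1) + (_ + 1) ≤ r + 1
    omega
  have h₄ : Nat.findGreatest P (r + 1) + 1 ≤ r + 1 := (Nat.le_add_left _ _).trans h₃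
  have := Nat.le_findGreatest h₄ h₃
  omega

/-- Consecutive ranges do not overlap: that of `m` ends at `r + 1 = 2 ^ (m + 1) + m`, one below the
start of the next. -/
theorem range_unique {m m' : ℕ} (h : r + 1 ≤ 2 ^ (m + 1) + m) (h' : 2 ^ m' + m' ≤ r + 1) :
    m' ≤ m := by
  by_contra hlt
  have : 2 ^ (m + 1) ≤ 2 ^ m' := Nat.pow_le_pow_right two_pos (by omega)
  omega

theorem existsUnique_range (hr : 2 ≤ r) :
    ∃! i : ℤ, (2 : ℚ) ^ (i - 1) + i - 2 ≤ r ∧ (r : ℚ) ≤ (2 : ℚ) ^ i + i - 2 := by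
  obtain ⟨m, -, hm⟩ := exists_range hr
  refine ⟨m + 1, zpow_range_iff.2 hm, fun i hi => ?_⟩
  obtain ⟨m', -, rfl⟩ := exists_nat_eq (two_le_of_le_zpow hr hi.2)
  have hm' := zpow_range_iff.1 hi
  have h₁ := range_unique hm.2 hm'.1
  have h₂ := range_unique hm'.2 hm.1
  omega

end Ranges

end GluedBinaryTree

theorem mainTheorem2 (r : ℕ) (hr : 2 ≤ r) :
    (∃! i : ℤ, (2 : ℚ) ^ (i - 1) + i - 2 ≤ r ∧ (r : ℚ) ≤ (2 : ℚ) ^ i + i - 2) ∧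
    ∀ i : ℤ,
      ((2 : ℚ) ^ (i - 1) + i - 2 ≤ r ∧
          (r : ℚ) ≤ (2 : ℚ) ^ (i - 1) + (2 : ℚ) ^ (i - 2) + i - 3 →
        (mutualVisibilityChromaticNumber (gluedBinaryTree r) : ℤ) = 2 * ((r : ℤ) - i) + 3) ∧
      ((2 : ℚ) ^ (i - 1) + (2 : ℚ) ^ (i - 2) + i - 2 ≤ r ∧
          (r : ℚ) ≤ (2 : ℚ) ^ i + i - 2 →
        (mutualVisibilityChromaticNumber (gluedBinaryTree r) : ℤ) = 2 * ((r : ℤ) - i) + 2) := by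
  refine ⟨GluedBinaryTree.existsUnique_range hr, fun i => ⟨?_, ?_⟩⟩
  · rintro ⟨h₁, h₂⟩
    have e₁ : (2 : ℚ) ^ (i - 1) = 2 * (2 : ℚ) ^ (i - 2) := by
      rw [show i - 1 = i - 2 + 1 by ring, zpow_add_one₀ two_ne_zero, mul_comm]
    have e₂ : (2 : ℚ) ^ i = 4 * (2 : ℚ) ^ (i - 2) := by
      rw [show (2 : ℚ) ^ i = (2 : ℚ) ^ (i - 2 + 2) by ring_nf, zpow_add₀ two_ne_zero]
      norm_num
      ring
    -- With `q = 2 ^ (i - 2)` the upper end `3 * q + i - 3` of this range is below `4 * q + i - 2`,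
    -- as needed for `2 ≤ i`.
    have hpos : (0 : ℚ) < (2 : ℚ) ^ (i - 2) := by positivity
    obtain ⟨m, hm, rfl⟩ := GluedBinaryTree.exists_nat_eq
      (GluedBinaryTree.two_le_of_le_zpow hr (i := i) (by linarith))
    rw [add_sub_cancel_right, zpow_natCast] at e₁ h₁ h₂
    push_cast at h₁ h₂
    have k₁ : 2 ^ m + m ≤ r + 1 := by
      have : (2 : ℚ) ^ m + m ≤ r + 1 := by linarith
      exact_mod_cast this
    have k₂ : 2 * r + 4 ≤ 3 * 2 ^ m + 2 * m := by
      have : 2 * (r : ℚ) + 4 ≤ 3 * 2 ^ m + 2 * m := by linarith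
      exact_mod_cast this
    rw [GluedBinaryTree.chromaticNumber_of_lower_half hm k₁ k₂]
    have := Nat.one_le_two_pow (n := m)
    push_cast [Nat.cast_sub (show m ≤ r by omega)]
    ring
  · rintro ⟨h₁, h₂⟩
    obtain ⟨m, hm, rfl⟩ := GluedBinaryTree.exists_nat_eq
      (GluedBinaryTree.two_le_of_le_zpow hr h₂)
    have e₁ : (2 : ℚ) ^ ((m : ℤ) + 1 - 1) = 2 * (2 : ℚ) ^ ((m : ℤ) + 1 - 2) := by
      rw [show (m : ℤ) + 1 - 1 = m + 1 - 2 + 1 by ring, zpow_add_one₀ two_ne_zero, mul_comm]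
    rw [zpow_add_one₀ two_ne_zero] at h₂
    rw [add_sub_cancel_right] at e₁ h₁
    rw [zpow_natCast] at e₁ h₁ h₂
    push_cast at h₁ h₂
    have k₁ : 3 * 2 ^ m + 2 * m ≤ 2 * r + 2 := by
      have : 3 * (2 : ℚ) ^ m + 2 * m ≤ 2 * r + 2 := by linarith
      exact_mod_cast this
    have k₂ : r + 1 ≤ 2 * 2 ^ m + m := by
      have : (r : ℚ) + 1 ≤ 2 * 2 ^ m + m := by linarith
      exact_mod_cast this
    rw [GluedBinaryTree.chromaticNumber_of_upper_half hm k₁ k₂]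
    have := Nat.one_le_two_pow (n := m)
    push_cast [Nat.cast_sub (show m ≤ r by omega)]
    ring
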